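/- Let $T$ be a non-empty compact Hausdorff space and let $\mathcal A$ be a collection of closed subsets of $T$ that contains $\emptyset$ and $T$, is closed under arbitrary intersections, contains no two disjoint non-empty sets, and is separable from above: there are finite collections $\mathcal A_1\subseteq\mathcal A_2\subseteq\cdots\subseteq\mathcal A$, each closed under intersections, and maps $g_n$ from $\mathcal A$ to the finite unions of sets of $\mathcal A_n$ with $g_n(\emptyset)=\emptyset$, $g_{n+1}(A)\subseteq g_n(A)$, $A\subseteq g_n(A)^\circ$ and $A=\bigcap_n g_n(A)$ for all $A\in\mathcal A$, such that $g_n$ preserves arbitrary intersections and $\bigcup_i A_i=\bigcup_j A'_j$ (finite unions in $\mathcal A$) implies $\bigcup_i g_n(A_i)=\bigcup_j g_n(A'_j)$. Let $\emptyset'$ be the intersection of all non-empty sets of $\mathcal A$, let $\mathcal A(u)$ be the class of finite unions of sets of $\mathcal A$, $\mathcal C=\{A\setminus B: A\in\mathcal A,\ B\in\mathcal A(u)\}$, and $\mathcal C(u)$ the class of finite unions of sets of $\mathcal C$. A transition system $\mathcal Q=(Q_{BB'})$ is a family of transition probabilities on $\mathbb R$, indexed by the pairs of non-empty $B\subseteq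 B'$ in $\mathcal A(u)$, with $Q_{BB}(x;\cdot)=\delta_x$ and $Q_{BB''}(x;\Gamma)=\int Q_{B'B''}(y;\Gamma)\,Q_{BB'}(x;dy)$ for all $B\subseteq B'\subseteq B''$, $x\in\mathbb R$ and Borel $\Gamma$. A consistent ordering of a finite non-empty collection $\mathcal A'\subseteq\mathcal A$ of non-empty sets closed under intersections is an enumeration $A_1,\dots,A_n$ of its distinct members in which every set comes after all its proper subsets; put $A_0=\emptyset'$. Let $\mu$ be a probability measure on $\mathbb R$ and let $\mathcal Q$ be a transition system satisfying the following consistency assumption: whenever $A_1,\dots,A_n$ and $A'_1,\dots,A'_n$ are two consistent orderings of the same $\mathcal A'$ and $\pi$ is the permutation of $\{1,\dots,n\}$ with $A_i=A'_{\pi(i)}$ for all $i$ (so $\pi(1)=1$), then for all Borel sets $\Gamma_0,\dots,\Gamma_n$ $$\int_{\mathbb R^{n+1}} I_{\Gamma_0}(x_0)I_{\Gamma_1}(x_1)\prod_{i=2}^n I_{\Gamma_i}(x_i-x_{i-1})\,Q_{\cup_{j\le n-1}A_j,\cup_{j\le n}A_j}(x_{n-1};dx_n)\cdots Q_{\emptyset'A_1}(x_0;dx_1)\,\mu(dx_0)$$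 $$=\int_{\mathbb R^{n+1}} I_{\Gamma_0}(y_0)I_{\Gamma_1}(y_1)\prod_{i=2}^n I_{\Gamma_i}(y_{\pi(i)}-y_{\pi(i)-1})\,Q_{\cup_{j\le n-1}A'_j,\cup_{j\le n}A'_j}(y_{n-1};dy_n)\cdots Q_{\emptyset'A'_1}(y_0;dy_1)\,\mu(dy_0).$$ Then there exist a probability space $(\Omega,\mathcal F,P)$ and a real-valued process $X=(X_A)_{A\in\mathcal A}$ on it such that: 1. $X$ has an almost surely unique additive extension to $\mathcal C(u)$, i.e. an almost surely unique family $(X_C)_{C\in\mathcal C(u)}$ extending $X$ such that $X_\emptyset=0$ a.s. and, for all $C_1,\dots,C_n\in\mathcal C$, $X_{C_1\cup\dots\cup C_n}=\sum_i X_{C_i}-\sum_{i<j}X_{C_i\cap C_j}+\dots+(-1)^{n+1}X_{C_1\cap\dots\cap C_n}$ a.s.; 2. $X$ is $\mathcal Q$-Markov: for all non-empty $B\subseteq B'$ in $\mathcal A(u)$ and all Borel $\Gamma\subseteq\mathbb R$, $P[X_{B'}\in\Gamma\mid\mathcal F_B]=Q_{BB'}(X_B;\Gamma)$ a.s., where $\mathcal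 F_B=\sigma(X_A: A\in\mathcal A,\ A\subseteq B)$; 3. $X$ has initial distribution $\mu$, i.e. $X_{\emptyset'}$ has law $\mu$. -/

import Mathlib

open MeasureTheory ProbabilityTheory

universe u

/-- The class of all finite unions of members of `G`. -/
def finiteUnions {T : Type u} (G : Set (Set T)) : Set (Set T) :=
  {B | ∃ (n : ℕ) (A : Fin n → Set T), (∀ i, A i ∈ G) ∧ B = ⋃ i, A i}

/-- Separability from above of a collection `𝒜`: there are finite sub-semilattices `𝒜ₙ`,
increasing in `n`, and maps `gₙ` from `𝒜` to the finite unions of sets of `𝒜ₙ` which approximate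
every member of `𝒜` from above, preserve arbitrary intersections and are compatible with finite
unions. -/
def SeparableFromAbove {T : Type u} [TopologicalSpace T] (𝒜 : Set (Set T)) : Prop :=
  ∃ (S : ℕ → Set (Set T)) (g : ℕ → Set T → Set T),
    (∀ n, S n ⊆ 𝒜 ∧ (S n).Finite ∧ (∀ A ∈ S n, ∀ B ∈ S n, A ∩ B ∈ S n) ∧ S n ⊆ S (n + 1)) ∧
    (∀ n, ∀ A ∈ 𝒜, g n A ∈ finiteUnions (S n) ∧ g (n + 1) A ⊆ g n A ∧ A ⊆ interior (g n A)) ∧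
    (∀ A ∈ 𝒜, A = ⋂ n, g n A) ∧
    (∀ n, ∀ E ⊆ 𝒜, E.Nonempty → g n (⋂₀ E) = ⋂ A ∈ E, g n A) ∧
    (∀ (n k m : ℕ) (A : Fin k → Set T) (A' : Fin m → Set T),
      (∀ i, A i ∈ 𝒜) → (∀ j, A' j ∈ 𝒜) → (⋃ i, A i) = (⋃ j, A' j) →
        (⋃ i, g n (A i)) = ⋃ j, g n (A' j)) ∧
    (∀ n, g n ∅ = ∅)

/-- An indexing collection on `T`. -/
structure IndexingCollection (T : Type u) [TopologicalSpace T] where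
  /-- the members of the collection -/
  sets : Set (Set T)
  isClosed : ∀ A ∈ sets, IsClosed A
  sInter_mem : ∀ E ⊆ sets, E.Nonempty → ⋂₀ E ∈ sets
  empty_mem : ∅ ∈ sets
  univ_mem : Set.univ ∈ sets
  inter_nonempty : ∀ A ∈ sets, ∀ B ∈ sets, A.Nonempty → B.Nonempty → (A ∩ B).Nonempty
  separable : SeparableFromAbove sets

namespace IndexingCollection

variable {T : Type u} [TopologicalSpace T]

/-- `𝒜(u)`: finite unions of members of `𝒜`. -/
def Au (𝒜 : IndexingCollection T) : Set (Set T) := finiteUnions 𝒜.sets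

/-- `𝒞`: the sets `A \ B` with `A ∈ 𝒜` and `B ∈ 𝒜(u)`. -/
def C (𝒜 : IndexingCollection T) : Set (Set T) :=
  {D | ∃ A ∈ 𝒜.sets, ∃ B ∈ 𝒜.Au, D = A \ B}

/-- `𝒞(u)`: finite unions of members of `𝒞`. -/
def Cu (𝒜 : IndexingCollection T) : Set (Set T) := finiteUnions 𝒜.C

/-- `∅'`: the intersection of all nonempty members of `𝒜`. -/
def minSet (𝒜 : IndexingCollection T) : Set T := ⋂₀ {A | A ∈ 𝒜.sets ∧ A.Nonempty}

theorem minSet_mem [Nonempty T] (𝒜 : IndexingCollection T) : 𝒜.minSet ∈ 𝒜.sets :=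
  𝒜.sInter_mem _ (fun _ hA => hA.1) ⟨Set.univ, 𝒜.univ_mem, Set.univ_nonempty⟩

/-- A finite sub-semilattice of `𝒜`, consisting of nonempty sets. -/
structure IsFiniteSubsemilattice (𝒜 : IndexingCollection T) (S : Set (Set T)) : Prop where
  subset : S ⊆ 𝒜.sets
  finite : S.Finite
  nonempty : S.Nonempty
  nonempty_of_mem : ∀ A ∈ S, A.Nonempty
  inter_mem : ∀ A ∈ S, ∀ B ∈ S, A ∩ B ∈ S

end IndexingCollection

/-- `A 0, …, A (n - 1)` is an enumeration of the distinct members of `S` in which a set is never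
numbered before any of its proper subsets. (The term `∅'`, which the usual notation puts in front of
the enumeration, is not part of `A`; see `chainSet`.) -/
structure IsConsistentOrdering {T : Type u} (S : Set (Set T)) {n : ℕ} (A : Fin n → Set T) :
    Prop where
  injective : Function.Injective A
  range_eq : Set.range A = S
  consistent : ∀ i j, A i ⊂ A j → i < j

/-- The increasing chain `∅', ∅' ∪ A 0, ∅' ∪ A 0 ∪ A 1, …`. -/
def chainSet {T : Type u} [TopologicalSpace T] (𝒜 : IndexingCollection T) {n : ℕ}
    (A : Fin n → Set T) (k : ℕ) : Set T :=
  𝒜.minSet ∪ ⋃ j : Fin n, ⋃ _ : (j : ℕ) < k, A j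

/-- A transition system: transition probabilities `Q B B'` on `ℝ` for nonempty `B ⊆ B'` in `𝒜(u)`
(the values of `kernel` at other pairs are irrelevant). -/
structure TransitionSystem {T : Type u} [TopologicalSpace T] (𝒜 : IndexingCollection T) where
  /-- the transition probability from `B` to `B'` -/
  kernel : Set T → Set T → Kernel ℝ ℝ
  isMarkovKernel : ∀ B ∈ 𝒜.Au, ∀ B' ∈ 𝒜.Au, B.Nonempty → B ⊆ B' → IsMarkovKernel (kernel B B')
  kernel_self : ∀ B ∈ 𝒜.Au, B.Nonempty → ∀ x, kernel B B x = Measure.dirac x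
  chapman_kolmogorov : ∀ B ∈ 𝒜.Au, ∀ B' ∈ 𝒜.Au, ∀ B'' ∈ 𝒜.Au, B.Nonempty → B ⊆ B' → B' ⊆ B'' →
    ∀ (x : ℝ) (Γ : Set ℝ), MeasurableSet Γ →
      kernel B B'' x Γ = ∫⁻ y, kernel B' B'' y Γ ∂(kernel B B' x)

namespace TransitionSystem

variable {T : Type u} [TopologicalSpace T] {𝒜 : IndexingCollection T}

/-- The measure `Q_{U (n-1), U n}(x_{n-1}; dx_n) ⋯ Q_{U 0, U 1}(x_0; dx_1) μ(dx_0)` on `ℝ^{n+1}`. -/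
noncomputable def chainLaw (Q : TransitionSystem 𝒜) (μ : Measure ℝ) (U : ℕ → Set T) :
    (n : ℕ) → Measure (Fin (n + 1) → ℝ)
  | 0 => μ.map (fun x _ => x)
  | n + 1 =>
    ((Q.chainLaw μ U n) ⊗ₘ ((Q.kernel (U n) (U (n + 1))).comap
      (fun x : Fin (n + 1) → ℝ => x (Fin.last n)) (measurable_pi_apply _))).map
      (fun p => (Fin.snoc p.1 p.2 : Fin (n + 2) → ℝ))

/-- The value over the left neighbourhood with (zero-based) number `i` along `x_0, …, x_n`: it is
`x_1` for the first set of the ordering and `x_{i+1} - x_i` for the later ones. -/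
def leftValue {n : ℕ} (x : Fin (n + 1) → ℝ) (i : Fin n) : ℝ :=
  if (i : ℕ) = 0 then x i.succ else x i.succ - x i.castSucc

/-- The consistency assumption: the law over the left neighbourhoods of a finite sub-semilattice
does not depend on the consistent ordering. -/
def Consistent (Q : TransitionSystem 𝒜) (μ : Measure ℝ) : Prop :=
  ∀ (S : Set (Set T)), 𝒜.IsFiniteSubsemilattice S →
    ∀ (n : ℕ) (A A' : Fin n → Set T), IsConsistentOrdering S A → IsConsistentOrdering S A' →
    ∀ π : Equiv.Perm (Fin n), (∀ i : Fin n, (i : ℕ) = 0 → π i = i) → (∀ i, A i = A' (π i)) →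
    ∀ (Γ₀ : Set ℝ) (Γ : Fin n → Set ℝ), MeasurableSet Γ₀ → (∀ i, MeasurableSet (Γ i)) →
      Q.chainLaw μ (chainSet 𝒜 A) n {x | x 0 ∈ Γ₀ ∧ ∀ i, leftValue x i ∈ Γ i} =
      Q.chainLaw μ (chainSet 𝒜 A') n {y | y 0 ∈ Γ₀ ∧ ∀ i, leftValue y (π i) ∈ Γ i}

end TransitionSystem

section Processes

variable {T : Type u} [TopologicalSpace T] {𝒜 : IndexingCollection T}
  {Ω : Type u} [MeasurableSpace Ω]

/-- The inclusion-exclusion sum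
`∑ᵢ Y (D i) - ∑_{i<j} Y (D i ∩ D j) + ⋯ + (-1)^(n+1) Y (D 0 ∩ ⋯ ∩ D (n-1))`. -/
def inclExcl (Y : Set T → Ω → ℝ) {n : ℕ} (D : Fin n → Set T) (ω : Ω) : ℝ :=
  ∑ J : Finset (Fin n) with J.Nonempty, (-1 : ℝ) ^ (J.card + 1) * Y (⋂ i ∈ J, D i) ω

/-- `Y` (of which only the values on `𝒞(u)` matter) is an almost surely additive extension to
`𝒞(u)` of the process `X` indexed by `𝒜`: whenever a set is written as a finite union of sets
in `𝒞`, its value is a.s. the inclusion-exclusion sum. The empty union gives `Y ∅ = 0` a.s. -/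
def IsAdditiveExtension (P : Measure Ω) (X : 𝒜.sets → Ω → ℝ) (Y : Set T → Ω → ℝ) : Prop :=
  (∀ A : 𝒜.sets, Y A =ᵐ[P] X A) ∧
  ∀ (n : ℕ) (D : Fin n → Set T), (∀ i, D i ∈ 𝒜.C) → Y (⋃ i, D i) =ᵐ[P] inclExcl Y D

/-- `X` has an almost surely unique additive extension to `𝒞(u)`. -/
def HasUniqueAdditiveExtension (P : Measure Ω) (X : 𝒜.sets → Ω → ℝ) : Prop :=
  (∃ Y, IsAdditiveExtension P X Y) ∧
  ∀ Y Y', IsAdditiveExtension P X Y → IsAdditiveExtension P X Y' →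
    ∀ D ∈ 𝒜.Cu, Y D =ᵐ[P] Y' D

/-- The minimal filtration `ℱ_B = σ(X_A; A ∈ 𝒜, A ⊆ B)`. -/
abbrev history (X : 𝒜.sets → Ω → ℝ) (B : Set T) : MeasurableSpace Ω :=
  ⨆ (A : 𝒜.sets) (_ : (A : Set T) ⊆ B), MeasurableSpace.comap (X A) inferInstance

/-- `X` is a `Q`-Markov process: it has an a.s. unique additive extension to `𝒞(u)` and
`P[X_{B'} ∈ Γ | ℱ_B] = Q_{BB'}(X_B; Γ)` a.s. for all nonempty `B ⊆ B'` in `𝒜(u)` and all Borel `Γ`,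
where `X_B` and `X_{B'}` are the values of the extension. -/
def IsQMarkov (Q : TransitionSystem 𝒜) (P : Measure Ω) (X : 𝒜.sets → Ω → ℝ) : Prop :=
  (∀ A, Measurable (X A)) ∧ HasUniqueAdditiveExtension P X ∧
  ∀ Y, IsAdditiveExtension P X Y →
    ∀ B ∈ 𝒜.Au, ∀ B' ∈ 𝒜.Au, B.Nonempty → B ⊆ B' → ∀ Γ : Set ℝ, MeasurableSet Γ →
      P[(Y B' ⁻¹' Γ).indicator (fun _ => (1 : ℝ)) | history X B]
        =ᵐ[P] fun ω => (Q.kernel B B' (Y B ω)).real Γ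

end Processes

/-! ### Kolmogorov's extension theorem for arbitrary index sets -/

section Kolmogorov

open Filter Topology
open scoped ENNReal

/-! The process is the coordinate process on `𝒜.sets → ℝ`, under a law obtained by Kolmogorov
extension from finite-dimensional distributions that `Q` and `μ` prescribe.

Given finitely many sets of `𝒜`, close them and `∅'` under nonempty intersections to get a finite
semilattice `S`. A consistent ordering of `S` produces an increasing chain in `𝒜(u)`, and `chainLaw`
is the law of a Markov chain moving along it. Each increment is read as the value over a left
neighbourhood, and the value at `a ∈ S` is the sum of the increments of those `A i` with `A i ⊆ a`
(`orderingValue`). The consistency assumption removes the dependence on the ordering. To compare `S`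
with a larger `S'`, order `S'` so that the chain of `S` becomes a subchain; by Chapman–Kolmogorov
the chain law restricts to the subchain. This is projectivity (`chainLaw_map_orderingValue_eq`).

The main device is `chainLaw_ae_exists_mass`. Since `Q_{BB}(x; ·) = δ_x`, an increment over an empty
left neighbourhood vanishes almost surely, so each remaining increment can be placed as a point mass
inside its own left neighbourhood. Almost surely, then, the chain values are those of a finitely
supported signed measure. Every linear relation among indicators of sets of `𝒜` thereby becomes an
almost sure relation among coordinates, and additivity reduces to inclusion–exclusion for
indicators. Uniqueness of the extension is a formal consequence of additivity.

For the Markov property, order a semilattice containing the finitely many constituents of `B` and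
`B'` so that both sets occur in the chain. Finitely many past values are then functions of the path
up to `B`, and the Markov property of the chain gives the joint law with the value at `B'`
(`HasChainLaws.map_eq_compProd`). Uniqueness of projective limits passes from finitely many past
coordinates to the whole history. -/

theorem projectiveFamilyContent_tendsto_zero_of_compactSpace {ι : Type*} {α : ι → Type*}
    [∀ i, TopologicalSpace (α i)] [∀ i, CompactSpace (α i)]
    [∀ i, TopologicalSpace.PseudoMetrizableSpace (α i)] [∀ i, SecondCountableTopology (α i)]
    [∀ i, MeasurableSpace (α i)] [∀ i, BorelSpace (α i)]
    {P : ∀ J : Finset ι, Measure (∀ j : J, α j)} [∀ J, IsFiniteMeasure (P J)]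
    (hP : IsProjectiveMeasureFamily P) {A : ℕ → Set (∀ i, α i)}
    (A_mem : ∀ n, A n ∈ measurableCylinders α) (A_anti : Antitone A) (A_inter : ⋂ n, A n = ∅) :
    Tendsto (fun n ↦ projectiveFamilyContent hP (A n)) atTop (𝓝 0) := by
  have A_cyl n : ∃ s S, MeasurableSet S ∧ A n = cylinder s S :=
    (mem_measurableCylinders _).1 (A_mem n)
  choose s S mS A_eq using A_cyl
  refine ENNReal.tendsto_atTop_zero.2 fun ε hε => ?_
  -- The errors of the inner approximations by closed sets below must have total at most `ε`.
  obtain ⟨δ, δ_pos, hδ⟩ := ENNReal.exists_pos_sum_of_countable hε.ne' ℕ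
  have hF n : ∃ F ⊆ S n, IsClosed F ∧ P (s n) (S n \ F) < δ n :=
    (mS n).exists_isClosed_sdiff_lt (measure_ne_top _ _) (by simpa using (δ_pos n).ne')
  choose F hFS hFc hFδ using hF
  have hcl n : IsClosed (cylinder (s n) (F n)) :=
    (hFc n).preimage (continuous_pi fun i => continuous_apply _)
  -- The closed cylinders have empty intersection, so compactness of the product gives a finite
  -- subfamily with empty intersection. A late `A n` lies in all the corresponding `A k`, hence is
  -- covered by finitely many of the small differences.
  obtain ⟨t, ht⟩ := isCompact_univ.elim_finite_subfamily_closed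
    (fun n => cylinder (s n) (F n)) hcl (by
      rw [Set.univ_inter, ← Set.subset_empty_iff, ← A_inter]
      refine Set.iInter_mono fun n => ?_
      rw [A_eq]
      exact Set.preimage_mono (hFS n))
  rw [Set.univ_inter] at ht
  obtain ⟨N, hN⟩ : ∃ N, ∀ i ∈ t, i ≤ N := ⟨t.sup id, fun i hi => Finset.le_sup (f := id) hi⟩
  refine ⟨N, fun n hn => ?_⟩
  have hmem k : cylinder (s k) (S k \ F k) ∈ measurableCylinders α :=
    cylinder_mem_measurableCylinders _ _ ((mS k).diff (hFc k).measurableSet)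
  have hsub : A n ⊆ ⋃ k ≤ N, cylinder (s k) (S k \ F k) := by
    intro x hx
    have hx' : x ∉ ⋂ i ∈ t, cylinder (s i) (F i) := by rw [ht]; exact Set.notMem_empty x
    simp only [Set.mem_iInter, not_forall] at hx'
    obtain ⟨k, hk, hxk⟩ := hx'
    refine Set.mem_iUnion₂.2 ⟨k, hN k hk, ?_, hxk⟩
    have := A_anti ((hN k hk).trans hn) hx
    rwa [A_eq k] at this
  calc projectiveFamilyContent hP (A n)
      ≤ projectiveFamilyContent hP (⋃ k ≤ N, cylinder (s k) (S k \ F k)) := by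
        refine projectiveFamilyContent_mono hP (A_mem n) ?_ hsub
        have := isSetRing_measurableCylinders.biUnion_mem (Finset.range (N + 1))
          (fun k _ => hmem k)
        simpa only [Finset.mem_range_succ_iff] using this
    _ ≤ ∑ k ∈ Finset.range (N + 1), projectiveFamilyContent hP (cylinder (s k) (S k \ F k)) :=
        projectiveFamilyContent_iUnion_le hP hmem N
    _ ≤ ∑ k ∈ Finset.range (N + 1), (δ k : ℝ≥0∞) := by
        refine Finset.sum_le_sum fun k _ => ?_
        rw [projectiveFamilyContent_cylinder hP ((mS k).diff (hFc k).measurableSet)]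
        exact (hFδ k).le
    _ ≤ ∑' k, (δ k : ℝ≥0∞) := ENNReal.sum_le_tsum _
    _ ≤ ε := hδ.le

/-- The Kolmogorov extension theorem for compact metrizable spaces. -/
theorem exists_isProjectiveLimit_of_compactSpace {ι : Type*} {α : ι → Type*}
    [∀ i, TopologicalSpace (α i)] [∀ i, CompactSpace (α i)]
    [∀ i, TopologicalSpace.PseudoMetrizableSpace (α i)] [∀ i, SecondCountableTopology (α i)]
    [∀ i, MeasurableSpace (α i)] [∀ i, BorelSpace (α i)]
    {P : ∀ J : Finset ι, Measure (∀ j : J, α j)} [∀ J, IsFiniteMeasure (P J)]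
    (hP : IsProjectiveMeasureFamily P) : ∃ ν : Measure (∀ i, α i), IsProjectiveLimit ν P := by
  have hsub : (projectiveFamilyContent hP).IsSigmaSubadditive := by
    refine isSigmaSubadditive_of_addContent_iUnion_eq_tsum
      isSetRing_measurableCylinders (fun f hf hf_Union hf' ↦ ?_)
    exact addContent_iUnion_eq_sum_of_tendsto_zero isSetRing_measurableCylinders
      (projectiveFamilyContent hP) (fun s hs ↦ projectiveFamilyContent_ne_top _)
      (fun _ ↦ projectiveFamilyContent_tendsto_zero_of_compactSpace hP) hf hf_Union hf'
  refine ⟨(projectiveFamilyContent hP).measure isSetSemiring_measurableCylinders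
      generateFrom_measurableCylinders.ge hsub, fun I => ?_⟩
  ext s hs
  rw [Measure.map_apply (Finset.measurable_restrict I) hs, AddContent.measure_eq, ← cylinder,
    projectiveFamilyContent_cylinder hP hs]
  · exact generateFrom_measurableCylinders.symm
  · exact cylinder_mem_measurableCylinders _ _ hs

/-- The Kolmogorov extension theorem for real-valued processes. -/
theorem exists_isProjectiveLimit_real {ι : Type*}
    {P : ∀ J : Finset ι, Measure (J → ℝ)} [∀ J, IsFiniteMeasure (P J)]
    (hP : IsProjectiveMeasureFamily (α := fun _ => ℝ) P) :
    ∃ ν : Measure (ι → ℝ), IsProjectiveLimit (α := fun _ => ℝ) ν P := by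
  -- The real laws are pushed into the compact space `EReal`, extended there, and brought back by
  -- `toReal`, a left inverse of the embedding.
  let e (J : Finset ι) (x : J → ℝ) (j : J) : EReal := x j
  have he J : Measurable (e J) := by unfold e; fun_prop
  have hP' : IsProjectiveMeasureFamily (α := fun _ => EReal) fun J => (P J).map (e J) := by
    intro I J hJI
    have h : Measurable (Finset.restrict₂ (π := fun _ : ι => EReal) hJI) :=
      Finset.measurable_restrict₂ _
    have h' : Measurable (Finset.restrict₂ (π := fun _ : ι => ℝ) hJI) :=
      Finset.measurable_restrict₂ _
    rw [Measure.map_map h (he I)]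
    change (P J).map (e J) = _
    rw [hP I J hJI, Measure.map_map (he J) h']
    rfl
  have := fun J => Measure.isFiniteMeasure_map (P J) (e J)
  obtain ⟨ν, hν⟩ := exists_isProjectiveLimit_of_compactSpace hP'
  have hr : Measurable fun (x : ι → EReal) i => (x i).toReal := by fun_prop
  refine ⟨ν.map fun x i => (x i).toReal, fun I => ?_⟩
  have h : Measurable (Finset.restrict (π := fun _ : ι => EReal) I) :=
    Finset.measurable_restrict _
  have h' : Measurable (Finset.restrict (π := fun _ : ι => ℝ) I) := Finset.measurable_restrict _
  have hr' : Measurable fun (x : I → EReal) i => (x i).toReal := by fun_prop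
  calc (ν.map fun x i => (x i).toReal).map I.restrict
      = (ν.map I.restrict).map fun (x : I → EReal) i => (x i).toReal := by
        rw [Measure.map_map h' hr, Measure.map_map hr' h]; rfl
    _ = P I := by
        rw [hν I, Measure.map_map hr' (he I)]
        exact Measure.map_id

end Kolmogorov

/-! ### Markov chains along increasing sequences in `𝒜(u)` -/

section Chain

variable {T : Type u} [TopologicalSpace T] {𝒜 : IndexingCollection T}

/-- Increasing sequences of nonempty sets of `𝒜(u)`. -/
structure IsSetChain (𝒜 : IndexingCollection T) (U : ℕ → Set T) : Prop where
  mem : ∀ k, U k ∈ 𝒜.Au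
  nonempty : (U 0).Nonempty
  mono : Monotone U

theorem IsSetChain.nonempty_apply {U : ℕ → Set T} (hU : IsSetChain 𝒜 U) (k : ℕ) :
    (U k).Nonempty :=
  hU.nonempty.mono (hU.mono k.zero_le)

/-- The next step sees the current state only through `g`, so forgetting everything but `g` commutes
with taking that step. This permits discarding intermediate coordinates of a path. -/
theorem MeasureTheory.Measure.map_prodMap_compProd_comap {α β γ : Type*} [MeasurableSpace α]
    [MeasurableSpace β] [MeasurableSpace γ] (ν : Measure α) [SFinite ν] (κ : Kernel β γ)
    [IsSFiniteKernel κ] {g : α → β} (hg : Measurable g) :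
    (ν ⊗ₘ κ.comap g hg).map (Prod.map g id) = ν.map g ⊗ₘ κ := by
  refine Measure.ext_of_lintegral _ fun f hf => ?_
  rw [lintegral_map hf (by fun_prop), Measure.lintegral_compProd (by fun_prop),
    Measure.lintegral_compProd hf, lintegral_map (hf.lintegral_kernel_prod_right') hg]
  rfl

namespace TransitionSystem

variable (Q : TransitionSystem 𝒜) (μ : Measure ℝ) [IsProbabilityMeasure μ]

theorem isMarkovKernel_of_chain {U : ℕ → Set T} (hU : IsSetChain 𝒜 U) {n N : ℕ} (h : n ≤ N) :
    IsMarkovKernel (Q.kernel (U n) (U N)) :=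
  Q.isMarkovKernel _ (hU.mem n) _ (hU.mem N) (hU.nonempty_apply n) (hU.mono h)

/-- The kernel `Q_{BB'}` applied to the last coordinate of a path. -/
noncomputable abbrev lastKernel (B B' : Set T) (n : ℕ) : Kernel (Fin (n + 1) → ℝ) ℝ :=
  (Q.kernel B B').comap (fun x : Fin (n + 1) → ℝ => x (Fin.last n)) (measurable_pi_apply _)

theorem measurable_snoc (n : ℕ) : Measurable fun p : (Fin (n + 1) → ℝ) × ℝ =>
    (Fin.snoc p.1 p.2 : Fin (n + 2) → ℝ) := by
  refine measurable_pi_lambda _ fun i => ?_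
  refine Fin.lastCases ?_ (fun j => ?_) i
  · simpa using measurable_snd
  · simpa [Function.comp_def] using (measurable_pi_apply j).comp measurable_fst

theorem isProbabilityMeasure_chainLaw {U : ℕ → Set T} (hU : IsSetChain 𝒜 U) (n : ℕ) :
    IsProbabilityMeasure (Q.chainLaw μ U n) := by
  induction n with
  | zero =>
    exact Measure.isProbabilityMeasure_map (by fun_prop)
  | succ n ih =>
    have := Q.isMarkovKernel_of_chain hU n.le_succ
    exact Measure.isProbabilityMeasure_map (measurable_snoc n).aemeasurable

theorem lintegral_kernel_comp {B B' B'' : Set T} (hB : B ∈ 𝒜.Au) (hB' : B' ∈ 𝒜.Au)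
    (hB'' : B'' ∈ 𝒜.Au) (hne : B.Nonempty) (h : B ⊆ B') (h' : B' ⊆ B'') (x : ℝ)
    {f : ℝ → ENNReal} (hf : Measurable f) :
    ∫⁻ z, f z ∂(Q.kernel B B'' x) = ∫⁻ y, ∫⁻ z, f z ∂(Q.kernel B' B'' y) ∂(Q.kernel B B' x) := by
  have : Q.kernel B B'' x = (Q.kernel B B' x).bind (Q.kernel B' B'') := by
    ext Γ hΓ
    rw [Measure.bind_apply hΓ (Kernel.aemeasurable _),
      Q.chapman_kolmogorov B hB B' hB' B'' hB'' hne h h' x Γ hΓ]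
  rw [this, Measure.lintegral_bind (Kernel.aemeasurable _) hf.aemeasurable]

/-- The Markov property of the coordinates of a chain. -/
theorem chainLaw_map_castLE_last {U : ℕ → Set T} (hU : IsSetChain 𝒜 U) {n N : ℕ} (h : n ≤ N) :
    (Q.chainLaw μ U N).map (fun x => ((fun i : Fin (n + 1) => x (Fin.castLE (by omega) i)),
      x (Fin.last N))) = Q.chainLaw μ U n ⊗ₘ Q.lastKernel (U n) (U N) n := by
  induction N, h using Nat.le_induction with
  | base =>
    have := Q.isProbabilityMeasure_chainLaw μ hU n
    have hk : Q.lastKernel (U n) (U n) n = Kernel.deterministic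
        (fun x : Fin (n + 1) → ℝ => x (Fin.last n)) (measurable_pi_apply _) := by
      ext1 x
      rw [Kernel.deterministic_apply]
      exact Q.kernel_self _ (hU.mem n) (hU.nonempty_apply n) _
    rw [hk, Measure.compProd_deterministic]
    rfl
  | succ N h ih =>
    have := Q.isProbabilityMeasure_chainLaw μ hU n
    have := Q.isProbabilityMeasure_chainLaw μ hU N
    have := Q.isMarkovKernel_of_chain hU (n := n) (N := N + 1) (by omega)
    have := Q.isMarkovKernel_of_chain hU h
    have := Q.isMarkovKernel_of_chain hU N.le_succ
    refine Measure.ext_of_lintegral _ fun f hf => ?_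
    rw [chainLaw, Measure.map_map (by fun_prop) (measurable_snoc N)]
    have hcomp : ((fun x : Fin (N + 1 + 1) → ℝ =>
        ((fun i : Fin (n + 1) => x (Fin.castLE (by omega) i)), x (Fin.last (N + 1)))) ∘
        fun p : (Fin (N + 1) → ℝ) × ℝ => (Fin.snoc p.1 p.2 : Fin (N + 2) → ℝ)) =
        fun p => ((fun i : Fin (n + 1) => p.1 (Fin.castLE (by omega) i)), p.2) := by
      funext p
      refine Prod.ext (funext fun i => ?_) (by simp)
      have : (Fin.castLE (by omega) i : Fin (N + 2)) =
        Fin.castSucc (Fin.castLE (by omega) i : Fin (N + 1)) := rfl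
      simp only [Function.comp_apply, this, Fin.snoc_castSucc]
    rw [hcomp, lintegral_map hf (by fun_prop), Measure.lintegral_compProd (by fun_prop),
      Measure.lintegral_compProd hf]
    -- `G` integrates out the new last coordinate. It depends only on the first `n + 1` coordinates
    -- and on the value at `U N`, so the induction hypothesis applies, and Chapman–Kolmogorov merges
    -- the two transitions.
    let G : (Fin (n + 1) → ℝ) × ℝ → ENNReal :=
      fun p => ∫⁻ z, f (p.1, z) ∂(Q.kernel (U N) (U (N + 1)) p.2)
    have hG : Measurable G := by
      have : Measurable fun q : ((Fin (n + 1) → ℝ) × ℝ) × ℝ => f (q.1.1, q.2) := by fun_prop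
      exact this.lintegral_kernel_prod_right'
        (κ := (Q.kernel (U N) (U (N + 1))).comap Prod.snd measurable_snd)
    calc _ = ∫⁻ p, G p ∂((Q.chainLaw μ U N).map
          (fun x => ((fun i : Fin (n + 1) => x (Fin.castLE (by omega) i)), x (Fin.last N)))) := by
          rw [lintegral_map hG (by fun_prop)]
          rfl
      _ = _ := by
          rw [ih, Measure.lintegral_compProd hG]
          refine lintegral_congr fun x => ?_
          simp only [lastKernel, Kernel.comap_apply, G]
          exact (Q.lintegral_kernel_comp (hU.mem n) (hU.mem N) (hU.mem _) (hU.nonempty_apply n)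
            (hU.mono h) (hU.mono N.le_succ) _ (f := fun z => f (x, z)) (by fun_prop)).symm

theorem chainLaw_map_castLE {U : ℕ → Set T} (hU : IsSetChain 𝒜 U) {n N : ℕ} (h : n ≤ N) :
    (Q.chainLaw μ U N).map (fun x (i : Fin (n + 1)) => x (Fin.castLE (by omega) i)) =
      Q.chainLaw μ U n := by
  have := Q.isProbabilityMeasure_chainLaw μ hU n
  have := Q.isMarkovKernel_of_chain hU h
  rw [← Measure.fst_compProd (Q.chainLaw μ U n) (Q.lastKernel (U n) (U N) n),
    ← Q.chainLaw_map_castLE_last μ hU h, Measure.fst, Measure.map_map (by fun_prop) (by fun_prop)]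
  rfl

/-- The values of a chain along a subchain follow the law of the subchain. -/
theorem chainLaw_map_comp {U V : ℕ → Set T} (hU : IsSetChain 𝒜 U) (K N : ℕ)
    (m : Fin (K + 1) → Fin (N + 1)) (hm : Monotone m) (hm0 : m 0 = 0)
    (hV : ∀ k : Fin (K + 1), V k = U (m k)) :
    (Q.chainLaw μ U N).map (fun x => x ∘ m) = Q.chainLaw μ V K := by
  induction K generalizing N with
  | zero =>
    have h : (fun x : Fin (N + 1) → ℝ => x ∘ m) =
        fun x (i : Fin (0 + 1)) => x (Fin.castLE (by omega) i) := by
      funext x i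
      fin_cases i
      simp [hm0]
    rw [h, Q.chainLaw_map_castLE μ hU N.zero_le]
    rfl
  | succ K ih =>
    -- Only the last two selected positions matter for the induction step: the path is cut at `N'`,
    -- the coordinates strictly between `M` and `N'` are dropped, and the induction hypothesis
    -- treats the path up to `M`.
    let M : ℕ := (m (Fin.last K).castSucc).val
    let N' : ℕ := (m (Fin.last (K + 1))).val
    have hMN : M ≤ N' := hm (Fin.le_last _)
    have hN : N' ≤ N := Nat.lt_succ_iff.1 (m _).2
    have hle (k : Fin (K + 1)) : (m k.castSucc : ℕ) < M + 1 :=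
      Nat.lt_succ_iff.2 (hm (Fin.castSucc_le_castSucc_iff.2 (Fin.le_last k)))
    let m' : Fin (K + 1) → Fin (M + 1) := fun k => ⟨m k.castSucc, hle k⟩
    have ih' := ih M m' (fun i j hij => hm (Fin.castSucc_le_castSucc_iff.2 hij))
      (by ext; simpa [m'] using congrArg Fin.val hm0) (fun k => hV k.castSucc)
    have hVK : V K = U M := by simpa using hV (Fin.last K).castSucc
    have hVK' : V (K + 1) = U N' := by simpa using hV (Fin.last (K + 1))
    have := Q.isProbabilityMeasure_chainLaw μ hU M
    have := Q.isMarkovKernel_of_chain hU hMN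
    have hcomp : (fun x : Fin (N + 1) → ℝ => x ∘ m) =
        ((fun p : (Fin (K + 1) → ℝ) × ℝ => (Fin.snoc p.1 p.2 : Fin (K + 2) → ℝ)) ∘
          (Prod.map (fun x : Fin (M + 1) → ℝ => x ∘ m') id)) ∘
          (fun x : Fin (N' + 1) → ℝ => ((fun i : Fin (M + 1) => x (Fin.castLE (by omega) i)),
            x (Fin.last N'))) ∘ fun x (i : Fin (N' + 1)) => x (Fin.castLE (by omega) i) := by
      funext x i
      refine Fin.lastCases ?_ (fun j => ?_) i
      · simp only [Function.comp_apply, Prod.map_apply, Fin.snoc_last, id]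
        rfl
      · simp only [Function.comp_apply, Prod.map_apply, Fin.snoc_castSucc, id]
        rfl
    have hm' : Measurable fun x : Fin (M + 1) → ℝ => x ∘ m' :=
      measurable_pi_lambda _ fun i => measurable_pi_apply _
    rw [hcomp, ← Measure.map_map ((measurable_snoc K).comp (hm'.prodMap measurable_id))
      (by fun_prop), ← Measure.map_map (measurable_snoc K) (hm'.prodMap measurable_id),
      ← Measure.map_map (by fun_prop) (by fun_prop), Q.chainLaw_map_castLE μ hU hN,
      Q.chainLaw_map_castLE_last μ hU hMN]
    rw [chainLaw, ← ih', hVK, hVK', ← Measure.map_prodMap_compProd_comap _ _ hm']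
    rfl

/-- The transition from a set to itself is a Dirac kernel, so the path does not move where the chain
of sets does not grow. -/
theorem chainLaw_ae_succ_eq {U : ℕ → Set T} (hU : IsSetChain 𝒜 U) {N : ℕ} (i : Fin N)
    (hi : U (i + 1) = U i) :
    ∀ᵐ x ∂(Q.chainLaw μ U N), x i.succ = x i.castSucc := by
  have := Q.isProbabilityMeasure_chainLaw μ hU i
  have h : ∀ᵐ x ∂(Q.chainLaw μ U (i + 1)),
      x (Fin.last (i + 1)) = x (Fin.last (i : ℕ)).castSucc := by
    have hk : Q.lastKernel (U i) (U (i + 1)) i =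
        Kernel.deterministic (fun x : Fin ((i : ℕ) + 1) → ℝ => x (Fin.last (i : ℕ)))
          (measurable_pi_apply _) := by
      ext1 x
      rw [Kernel.deterministic_apply, hi]
      exact Q.kernel_self _ (hU.mem i) (hU.nonempty_apply i) _
    have h := Q.chainLaw_map_castLE_last μ hU (Nat.le_succ (i : ℕ))
    rw [hk, Measure.compProd_deterministic] at h
    have h1 : ∀ᵐ p ∂((Q.chainLaw μ U i).map fun x => (x, x (Fin.last (i : ℕ)))),
        p.2 = p.1 (Fin.last (i : ℕ)) := by
      rw [ae_map_iff (by fun_prop) (measurableSet_eq_fun (by fun_prop) (by fun_prop))]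
      exact Filter.Eventually.of_forall fun x => rfl
    rw [← h] at h1
    exact ae_of_ae_map (by fun_prop) h1
  rw [← Q.chainLaw_map_castLE μ hU (n := i + 1) (N := N) (by omega)] at h
  exact ae_of_ae_map (measurable_pi_lambda _ fun _ => measurable_pi_apply _).aemeasurable h

end TransitionSystem

end Chain

/-! ### Consistent orderings, left neighbourhoods and signed measures -/

section Combinatorics

variable {T : Type u}

theorem sUnion_mem_finiteUnions {G E : Set (Set T)} (hE : E.Finite) (hEG : E ⊆ G) :
    ⋃₀ E ∈ finiteUnions G := by
  have := hE.to_subtype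
  obtain ⟨n, ⟨e⟩⟩ := Finite.exists_equiv_fin E
  refine ⟨n, fun i => e.symm i, fun i => hEG (e.symm i).2, ?_⟩
  rw [Set.sUnion_eq_iUnion]
  exact (e.symm.surjective.iUnion_comp (fun a : E => (a : Set T))).symm

theorem exists_forall_iff_val_lt {n : ℕ} (p : Fin n → Prop)
    (hp : ∀ i j, i ≤ j → p j → p i) : ∃ m ≤ n, ∀ i : Fin n, p i ↔ (i : ℕ) < m := by
  induction n with
  | zero => exact ⟨0, le_rfl, fun i => i.elim0⟩
  | succ n ih =>
    by_cases h : p (Fin.last n)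
    · exact ⟨n + 1, le_rfl, fun i => ⟨fun _ => i.2, fun _ => hp _ _ (Fin.le_last i) h⟩⟩
    · obtain ⟨m, hm, hmp⟩ := ih (fun i => p i.castSucc)
        fun i j hij => hp _ _ (Fin.castSucc_le_castSucc_iff.2 hij)
      refine ⟨m, by omega, fun i => ?_⟩
      refine Fin.lastCases ?_ (fun j => hmp j) i
      simp only [h, Fin.val_last, false_iff]
      omega

/-- Ordering by the number of members of `S` below a set is already consistent. Putting a monotone
`key` first in the lexicographic order preserves consistency and leaves freedom to adapt the
ordering to given sets. -/
theorem exists_isConsistentOrdering {S : Set (Set T)} (hS : S.Finite) (key : Set T → ℕ)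
    (hkey : Monotone key) :
    ∃ (n : ℕ) (A : Fin n → Set T), IsConsistentOrdering S A ∧ Monotone (key ∘ A) := by
  have := hS.to_subtype
  obtain ⟨n, ⟨e⟩⟩ := Finite.exists_equiv_fin S
  let rank (a : Set T) : ℕ := {b ∈ S | b ⊆ a}.ncard
  let f : Fin n → ℕ ×ₗ ℕ := fun i => toLex (key (e.symm i), rank (e.symm i))
  have hf : Monotone (f ∘ Tuple.sort f) := Tuple.monotone_sort f
  refine ⟨n, fun i => e.symm (Tuple.sort f i), ⟨?_, ?_, fun i j hij => ?_⟩, fun i j hij => ?_⟩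
  · exact Subtype.val_injective.comp (e.symm.injective.comp (Tuple.sort f).injective)
  · ext a
    constructor
    · rintro ⟨i, rfl⟩
      exact Subtype.coe_prop _
    · intro ha
      exact ⟨(Tuple.sort f).symm (e ⟨a, ha⟩), by simp⟩
  · by_contra! h
    have h1 : key (e.symm (Tuple.sort f j)) < key (e.symm (Tuple.sort f i)) ∨
        key (e.symm (Tuple.sort f j)) = key (e.symm (Tuple.sort f i)) ∧
        rank (e.symm (Tuple.sort f j)) ≤ rank (e.symm (Tuple.sort f i)) :=
      Prod.Lex.toLex_le_toLex.1 (hf h)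
    have h2 : rank (e.symm (Tuple.sort f i)) < rank (e.symm (Tuple.sort f j)) := by
      refine Set.ncard_lt_ncard ⟨fun b hb => ⟨hb.1, hb.2.trans hij.1⟩, fun h => ?_⟩
        (hS.subset fun b hb => hb.1)
      exact hij.2 (h ⟨Subtype.coe_prop _, le_rfl⟩).2
    have h3 := hkey hij.1
    omega
  · rcases Prod.Lex.toLex_le_toLex.1 (hf hij) with h | h
    exacts [h.le, h.1.le]

/-- A finite collection has a consistent ordering along which the sets contained in `V k` form an
initial segment for all `k ≤ K`. -/
theorem exists_isConsistentOrdering_adapted {S : Set (Set T)} (hS : S.Finite) {V : ℕ → Set T}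
    (hV : Monotone V) (K : ℕ) :
    ∃ (n : ℕ) (A : Fin n → Set T) (m : ℕ → ℕ), IsConsistentOrdering S A ∧
      ∀ k ≤ K, m k ≤ n ∧ ∀ i, A i ⊆ V k ↔ (i : ℕ) < m k := by
  classical
  -- Since `V` increases, the indices `k` with `a ⊄ V k` form an initial segment. If `A j ⊆ V k` but
  -- `A i ⊄ V k`, then `A i` has the strictly larger key, so sorting by `key` puts the sets inside
  -- each `V k` first.
  let key (a : Set T) : ℕ := {k ∈ Finset.range (K + 1) | ¬ a ⊆ V k}.card
  have hkey : Monotone key := fun a b hab => Finset.card_le_card fun k hk => by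
    simp only [Finset.mem_filter] at hk ⊢
    exact ⟨hk.1, fun h => hk.2 (hab.trans h)⟩
  obtain ⟨n, A, hA, hmono⟩ := exists_isConsistentOrdering hS key hkey
  have h k : ∃ m, k ≤ K → m ≤ n ∧ ∀ i, A i ⊆ V k ↔ (i : ℕ) < m := by
    by_cases hk : k ≤ K
    · obtain ⟨m, hm, h⟩ := exists_forall_iff_val_lt (fun i => A i ⊆ V k) fun i j hij hj => by
        by_contra hi
        refine (hmono hij).not_gt (Finset.card_lt_card ⟨fun l hl => ?_, fun h => ?_⟩)
        · simp only [Finset.mem_filter] at hl ⊢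
          refine ⟨hl.1, fun h => hl.2 (hj.trans (hV ?_))⟩
          by_contra! hlk
          exact hi (h.trans (hV hlk.le))
        · have := h (x := k) (by simp only [Finset.mem_filter, Finset.mem_range]; exact ⟨by omega, hi⟩)
          simp only [Finset.mem_filter] at this
          exact this.2 hj
      exact ⟨m, fun _ => ⟨hm, h⟩⟩
    · exact ⟨0, fun h => absurd h hk⟩
  choose m hm using h
  exact ⟨n, A, m, hA, hm⟩

/-- The value at `D` of the finitely supported signed measure with weights `w`. -/
noncomputable def mass (w : T →₀ ℝ) (D : Set T) : ℝ :=
  w.sum fun t c => c * D.indicator 1 t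

open Classical in
/-- The value at `a` determined by the values `x` along a consistent ordering. -/
noncomputable def orderingValue {n : ℕ} (A : Fin n → Set T) (x : Fin (n + 1) → ℝ) (a : Set T) : ℝ :=
  ∑ i, if A i ⊆ a then TransitionSystem.leftValue x i else 0

theorem measurable_leftValue {n : ℕ} (i : Fin n) :
    Measurable fun x : Fin (n + 1) → ℝ => TransitionSystem.leftValue x i := by
  unfold TransitionSystem.leftValue
  split_ifs <;> fun_prop

theorem measurable_orderingValue {n : ℕ} (A : Fin n → Set T) (a : Set T) :
    Measurable fun x => orderingValue A x a := by
  refine Finset.measurable_sum _ fun i _ => ?_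
  split_ifs
  · exact measurable_leftValue i
  · exact measurable_const

/-- The sum telescopes without boundary term because the first left value is `x 1` itself and not `x
1 - x 0`. -/
theorem sum_filter_leftValue {n : ℕ} (x : Fin (n + 1) → ℝ) (k : ℕ) (hk : k < n) :
    ∑ i ∈ Finset.univ.filter (fun i : Fin n => (i : ℕ) < k + 1), TransitionSystem.leftValue x i =
      x ⟨k + 1, by omega⟩ := by
  induction k with
  | zero =>
    have : Finset.univ.filter (fun i : Fin n => (i : ℕ) < 0 + 1) = {⟨0, hk⟩} := by
      ext i
      simp [Fin.ext_iff]
    rw [this, Finset.sum_singleton]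
    simp [TransitionSystem.leftValue]
  | succ k ih =>
    have : Finset.univ.filter (fun i : Fin n => (i : ℕ) < k + 1 + 1) =
        insert ⟨k + 1, hk⟩ (Finset.univ.filter fun i : Fin n => (i : ℕ) < k + 1) := by
      ext i
      simp only [Finset.mem_filter, Finset.mem_univ, true_and, Finset.mem_insert, Fin.ext_iff]
      omega
    rw [this, Finset.sum_insert (by simp), ih (by omega)]
    simp [TransitionSystem.leftValue]

theorem leftValue_sum {n : ℕ} {ι : Type*} (s : Finset ι) (c : ι → ℝ) (x : ι → Fin (n + 1) → ℝ)
    (i : Fin n) : TransitionSystem.leftValue (fun k => ∑ j ∈ s, c j * x j k) i =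
      ∑ j ∈ s, c j * TransitionSystem.leftValue (x j) i := by
  unfold TransitionSystem.leftValue
  split_ifs
  · rfl
  · simp only [mul_sub, Finset.sum_sub_distrib]

theorem orderingValue_sum {n : ℕ} {ι : Type*} (s : Finset ι) (c : ι → ℝ)
    (x : ι → Fin (n + 1) → ℝ) (A : Fin n → Set T) (a : Set T) :
    orderingValue A (fun k => ∑ j ∈ s, c j * x j k) a =
      ∑ j ∈ s, c j * orderingValue A (x j) a := by
  simp only [orderingValue, leftValue_sum, Finset.mul_sum]
  rw [Finset.sum_comm]
  refine Finset.sum_congr rfl fun i _ => ?_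
  split_ifs <;> simp

open Classical in
/-- The values at sets preceding position `m` only involve the first `m + 1` coordinates. -/
theorem orderingValue_extend {n m : ℕ} {A : Fin n → Set T} {a : Set T}
    (ha : ∀ i, A i ⊆ a → (i : ℕ) < m) (x : Fin (n + 1) → ℝ) :
    orderingValue A (fun k => if (k : ℕ) < m + 1 then x k else 0) a = orderingValue A x a := by
  refine Finset.sum_congr rfl fun i _ => ?_
  split_ifs with h
  · have hi := ha i h
    have h1 : (i : ℕ) + 1 < m + 1 := by omega
    have h2 : (i : ℕ) < m + 1 := by omega
    simp only [TransitionSystem.leftValue, Fin.val_succ, Fin.val_castSucc, h1, h2, if_true]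
  · rfl

namespace IsConsistentOrdering

variable {n : ℕ} {A : Fin n → Set T} {S : Set (Set T)}

theorem mem (hA : IsConsistentOrdering S A) (i : Fin n) : A i ∈ S :=
  hA.range_eq ▸ Set.mem_range_self i

theorem exists_eq (hA : IsConsistentOrdering S A) {a : Set T} (ha : a ∈ S) : ∃ i, A i = a := by
  rwa [← hA.range_eq] at ha

theorem le_of_subset (hA : IsConsistentOrdering S A) {i j : Fin n} (h : A i ⊆ A j) : i ≤ j := by
  rcases h.eq_or_ssubset with h | h
  · exact (hA.injective h).le
  · exact (hA.consistent i j h).le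

end IsConsistentOrdering

variable [TopologicalSpace T] (𝒜 : IndexingCollection T)

namespace IndexingCollection

theorem minSet_subset {A : Set T} (hA : A ∈ 𝒜.sets) (hne : A.Nonempty) : 𝒜.minSet ⊆ A :=
  Set.sInter_subset_of_mem ⟨hA, hne⟩

theorem minSet_subset_of_mem_Au {B : Set T} (hB : B ∈ 𝒜.Au) (hne : B.Nonempty) :
    𝒜.minSet ⊆ B := by
  obtain ⟨n, A, hA, rfl⟩ := hB
  obtain ⟨i, hi⟩ := Set.nonempty_iUnion.1 hne
  exact (𝒜.minSet_subset (hA i) hi).trans (Set.subset_iUnion _ i)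

theorem inter_mem {A B : Set T} (hA : A ∈ 𝒜.sets) (hB : B ∈ 𝒜.sets) : A ∩ B ∈ 𝒜.sets := by
  rw [← Set.sInter_pair]
  exact 𝒜.sInter_mem _ (Set.pair_subset hA hB) (Set.insert_nonempty _ _)

theorem sInter_nonempty {E : Set (Set T)} (hE : E.Finite) (hsub : E ⊆ 𝒜.sets)
    (hne : ∀ A ∈ E, A.Nonempty) [Nonempty T] : (⋂₀ E).Nonempty := by
  suffices h : ⋂₀ E ∈ 𝒜.sets ∧ (⋂₀ E).Nonempty from h.2
  induction E, hE using Set.Finite.induction_on with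
  | empty => simpa using 𝒜.univ_mem
  | insert _ _ ih =>
    obtain ⟨h1, h2⟩ := ih (fun A hA => hsub (Set.mem_insert_of_mem _ hA))
      fun A hA => hne A (Set.mem_insert_of_mem _ hA)
    rw [Set.sInter_insert]
    have h3 := hsub (Set.mem_insert _ _)
    exact ⟨𝒜.inter_mem h3 h1, 𝒜.inter_nonempty _ h3 _ h1 (hne _ (Set.mem_insert _ _)) h2⟩

/-- The nonempty members are closed sets with the finite intersection property, so compactness
applies. -/
theorem minSet_nonempty [CompactSpace T] [Nonempty T] : 𝒜.minSet.Nonempty := by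
  unfold minSet
  rw [Set.sInter_eq_iInter, ← Set.univ_inter (⋂ _, _)]
  refine isCompact_univ.inter_iInter_nonempty _ (fun A => 𝒜.isClosed A A.2.1) fun u => ?_
  rw [Set.univ_inter]
  have := 𝒜.sInter_nonempty (E := Subtype.val '' (u : Set {A | A ∈ 𝒜.sets ∧ A.Nonempty}))
    (u.finite_toSet.image _) (by rintro _ ⟨A, -, rfl⟩; exact A.2.1)
    (by rintro _ ⟨A, -, rfl⟩; exact A.2.2)
  simpa [Set.sInter_image] using this

theorem isSetChain_chainSet [CompactSpace T] [Nonempty T] {n : ℕ} {A : Fin n → Set T}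
    (hA : ∀ i, A i ∈ 𝒜.sets) : IsSetChain 𝒜 (chainSet 𝒜 A) where
  mem k := by
    have : chainSet 𝒜 A k = ⋃₀ (insert 𝒜.minSet (A '' {j | (j : ℕ) < k})) := by
      simp [chainSet, Set.sUnion_image]
    rw [this]
    refine sUnion_mem_finiteUnions ((Set.toFinite _).insert _) ?_
    rintro _ (rfl | ⟨i, -, rfl⟩)
    exacts [𝒜.minSet_mem, hA i]
  nonempty := 𝒜.minSet_nonempty.mono Set.subset_union_left
  mono k l hkl := Set.union_subset_union_right _
    (Set.iUnion_mono fun j => Set.iUnion_mono' fun h => ⟨h.trans_le hkl, le_rfl⟩)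

end IndexingCollection

variable {𝒜} {n : ℕ} {A : Fin n → Set T} {S : Set (Set T)}

theorem minSet_subset_chainSet (A : Fin n → Set T) (k : ℕ) : 𝒜.minSet ⊆ chainSet 𝒜 A k :=
  Set.subset_union_left

theorem subset_chainSet (A : Fin n → Set T) {k : ℕ} {i : Fin n} (h : (i : ℕ) < k) :
    A i ⊆ chainSet 𝒜 A k :=
  (Set.subset_iUnion₂ (s := fun (j : Fin n) (_ : (j : ℕ) < k) => A j) i h).trans
    Set.subset_union_right

theorem mem_chainSet_iff {k : ℕ} {t : T} :
    t ∈ chainSet 𝒜 A k ↔ t ∈ 𝒜.minSet ∨ ∃ j : Fin n, (j : ℕ) < k ∧ t ∈ A j := by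
  simp [chainSet]

namespace IsConsistentOrdering

theorem apply_zero (hA : IsConsistentOrdering S A) (hS : 𝒜.IsFiniteSubsemilattice S)
    (hmin : 𝒜.minSet ∈ S) {i : Fin n} (hi : (i : ℕ) = 0) : A i = 𝒜.minSet := by
  obtain ⟨j, hj⟩ := hA.exists_eq hmin
  have h : A j ⊆ A i := hj ▸ 𝒜.minSet_subset (hS.subset (hA.mem i)) (hS.nonempty_of_mem _ (hA.mem i))
  have hji : j = i := Fin.ext (by have : (j : ℕ) ≤ i := hA.le_of_subset h; omega)
  rw [← hji, hj]

end IsConsistentOrdering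

/-- The part of `a` not covered by smaller members of `S`. -/
def leftNeighborhood (S : Set (Set T)) (a : Set T) : Set T :=
  a \ ⋃₀ {b ∈ S | b ⊂ a}

/-- Otherwise `a ∩ b` would be a smaller member of `S` containing `t`, and such members have been
removed from `a`. -/
theorem subset_of_mem_leftNeighborhood (hS : 𝒜.IsFiniteSubsemilattice S) {a b : Set T} {t : T}
    (ha : a ∈ S) (hb : b ∈ S) (ht : t ∈ leftNeighborhood S a) (htb : t ∈ b) : a ⊆ b := by
  by_contra h
  refine ht.2 ⟨a ∩ b, ⟨hS.inter_mem a ha b hb, Set.inter_subset_left, fun h' => ?_⟩, ht.1, htb⟩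
  exact h (h'.trans Set.inter_subset_right)

/-- Any `A j` containing `t` contains `A i`, hence does not precede it. A point mass at `t` thus
enters the chain exactly at the step that adds `A i`. Position `0` is excluded because `∅'` is
already present there, one step before `A 0 = ∅'` is added. -/
theorem mem_chainSet_iff_of_mem_leftNeighborhood (hA : IsConsistentOrdering S A)
    (hS : 𝒜.IsFiniteSubsemilattice S) (hmin : 𝒜.minSet ∈ S) {i : Fin n} {t : T}
    (ht : t ∈ leftNeighborhood S (A i)) {k : ℕ} (hk : 0 < k) :
    t ∈ chainSet 𝒜 A k ↔ (i : ℕ) < k := by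
  refine ⟨fun h => ?_, fun h => subset_chainSet A h ht.1⟩
  obtain ⟨j, hj, htj⟩ : ∃ j : Fin n, (j : ℕ) < k ∧ t ∈ A j := by
    rcases mem_chainSet_iff.1 h with h | h
    · obtain ⟨j, hj⟩ := hA.exists_eq hmin
      refine ⟨i, ?_, ht.1⟩
      have h1 := subset_of_mem_leftNeighborhood hS (hA.mem i) (hA.mem j) ht (hj ▸ h)
      have h2 : i ≤ j := hA.le_of_subset h1
      have h3 : (j : ℕ) = 0 := by
        let z : Fin n := ⟨0, i.pos⟩
        have : A z = A j := (hA.apply_zero hS hmin (i := z) rfl).trans hj.symm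
        rw [← hA.injective this]
      have : (i : ℕ) ≤ j := h2
      omega
    · exact h
  have : (i : ℕ) ≤ j := hA.le_of_subset
    (subset_of_mem_leftNeighborhood hS (hA.mem i) (hA.mem j) ht htj)
  omega

theorem chainSet_succ_of_leftNeighborhood_eq_empty (hA : IsConsistentOrdering S A) {i : Fin n}
    (h : leftNeighborhood S (A i) = ∅) : chainSet 𝒜 A (i + 1) = chainSet 𝒜 A i := by
  ext t
  simp only [mem_chainSet_iff]
  refine or_congr_right ⟨?_, fun ⟨j, hj, ht⟩ => ⟨j, by omega, ht⟩⟩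
  rintro ⟨j, hj, ht⟩
  rcases (Nat.lt_succ_iff.1 hj).lt_or_eq with hj | hj
  · exact ⟨j, hj, ht⟩
  · obtain rfl : j = i := Fin.ext hj
    by_contra hcon
    refine (h ▸ Set.notMem_empty t : t ∉ leftNeighborhood S (A j)) ⟨ht, ?_⟩
    rintro ⟨b, ⟨hb, hba⟩, htb⟩
    obtain ⟨l, rfl⟩ := hA.exists_eq hb
    exact hcon ⟨l, hA.consistent _ _ hba, htb⟩

theorem leftNeighborhood_zero_nonempty (hA : IsConsistentOrdering S A)
    (hS : 𝒜.IsFiniteSubsemilattice S) {i : Fin n} (hi : (i : ℕ) = 0) :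
    (leftNeighborhood S (A i)).Nonempty := by
  obtain ⟨t, ht⟩ := hS.nonempty_of_mem _ (hA.mem i)
  refine ⟨t, ht, ?_⟩
  rintro ⟨b, ⟨hb, hba⟩, -⟩
  obtain ⟨l, rfl⟩ := hA.exists_eq hb
  have : (l : ℕ) < i := hA.consistent _ _ hba
  omega

/-- The ordering recovers the indicator of a member from the indicators of the chain. -/
theorem orderingValue_indicator (hA : IsConsistentOrdering S A)
    (hS : 𝒜.IsFiniteSubsemilattice S) (hmin : 𝒜.minSet ∈ S) {a : Set T} (ha : a ∈ S ∨ a = ∅)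
    (t : T) : orderingValue A (fun k => (chainSet 𝒜 A k).indicator 1 t) a =
      a.indicator (1 : T → ℝ) t := by
  classical
  have hmem : ∀ i : Fin n, t ∈ A i → ∃ i : Fin n, t ∈ A i ∧ ∀ l, t ∈ A l → i ≤ l := fun i hi => by
    obtain ⟨i, hi⟩ := (Set.toFinite {i : Fin n | t ∈ A i}).exists_minimal ⟨i, hi⟩
    exact ⟨i, hi.prop, fun l hl => not_lt.1 fun h => (hi.not_lt hl) h⟩
  by_cases ht : ∃ i, t ∈ A i
  · obtain ⟨i, hi⟩ := ht
    obtain ⟨i, hi, hleast⟩ := hmem i hi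
    have hz : t ∈ 𝒜.minSet → (i : ℕ) = 0 := fun h => by
      let z : Fin n := ⟨0, i.pos⟩
      have : i ≤ z := hleast z (by rwa [hA.apply_zero hS hmin (i := z) rfl])
      exact Nat.le_zero.1 this
    have hchain : ∀ k, 0 < k → (t ∈ chainSet 𝒜 A k ↔ (i : ℕ) < k) := fun k hk => by
      refine ⟨fun h => ?_, fun h => subset_chainSet A h hi⟩
      rcases mem_chainSet_iff.1 h with h | ⟨j, hj, htj⟩
      · rw [hz h]; exact hk
      · exact lt_of_le_of_lt (hleast j htj) hj
    -- With `i` the first position such that `t ∈ A i`, the indicator along the chain jumps only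
    -- there, so the left values are a Kronecker delta.
    have hlv : ∀ j : Fin n, TransitionSystem.leftValue
        (fun k : Fin (n + 1) => (chainSet 𝒜 A k).indicator (1 : T → ℝ) t) j =
        if j = i then 1 else 0 := fun j => by
      unfold TransitionSystem.leftValue
      have h1 := hchain (j + 1) (by omega)
      split_ifs with h0 h2 h2
      · subst h2
        simp [Set.indicator, h1]
      · have : (i : ℕ) ≠ 0 := fun h => h2 (Fin.ext (by omega))
        simp only [Set.indicator, Fin.val_succ, h1, ite_eq_right_iff, Pi.one_apply]
        omega
      · subst h2
        have h3 := hchain j (by omega)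
        simp [Set.indicator, h1, h3]
      · have h3 := hchain j (by omega)
        have h4 : (j : ℕ) ≠ i := fun h => h2 (Fin.ext h)
        have h5 : (i : ℕ) < j + 1 ↔ (i : ℕ) < j := by omega
        simp [Set.indicator, h1, h3, h5]
    unfold orderingValue
    simp only [hlv]
    -- If `t ∈ a` but `A i ⊄ a`, then `A i ∩ a` is a proper subset of `A i` in `S` that contains
    -- `t`; it would come before `i`, against minimality.
    have hiff : A i ⊆ a ↔ t ∈ a := by
      refine ⟨fun h => h hi, fun h => ?_⟩
      rcases ha with ha | rfl
      · by_contra hcon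
        obtain ⟨l, hl⟩ := hA.exists_eq (hS.inter_mem _ (hA.mem i) _ ha)
        have h1 : A l ⊂ A i := hl ▸ ⟨Set.inter_subset_left,
          fun h' => hcon (h'.trans Set.inter_subset_right)⟩
        exact (hA.consistent _ _ h1).not_ge (hleast l (hl ▸ ⟨hi, h⟩))
      · exact absurd h (Set.notMem_empty t)
    rw [Finset.sum_eq_single i (fun j _ hj => by simp [hj]) (by simp)]
    simp [Set.indicator, hiff]
  · have hlv : ∀ k, t ∉ chainSet 𝒜 A k := fun k h => by
      rcases mem_chainSet_iff.1 h with h | ⟨j, -, hj⟩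
      · obtain ⟨j, hj⟩ := hA.exists_eq hmin
        exact ht ⟨j, hj ▸ h⟩
      · exact ht ⟨j, hj⟩
    have hta : t ∉ a := by
      rcases ha with ha | rfl
      · obtain ⟨j, rfl⟩ := hA.exists_eq ha
        exact fun h => ht ⟨j, h⟩
      · exact Set.notMem_empty t
    simp [orderingValue, TransitionSystem.leftValue, hlv, hta]

theorem orderingValue_mass (hA : IsConsistentOrdering S A)
    (hS : 𝒜.IsFiniteSubsemilattice S) (hmin : 𝒜.minSet ∈ S) {a : Set T} (ha : a ∈ S ∨ a = ∅)
    (w : T →₀ ℝ) : orderingValue A (fun k => mass w (chainSet 𝒜 A k)) a = mass w a := by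
  simp only [mass, Finsupp.sum]
  rw [orderingValue_sum w.support w (fun t (k : Fin (n + 1)) => (chainSet 𝒜 A k).indicator 1 t)]
  simp only [orderingValue_indicator hA hS hmin ha]

/-- Along a consistent ordering, the values of a chain are almost surely those of a finitely
supported signed measure. -/
theorem chainLaw_ae_exists_mass [CompactSpace T] [Nonempty T] (Q : TransitionSystem 𝒜)
    (μ : Measure ℝ) [IsProbabilityMeasure μ] (hA : IsConsistentOrdering S A)
    (hS : 𝒜.IsFiniteSubsemilattice S) (hmin : 𝒜.minSet ∈ S) :
    ∀ᵐ x ∂(Q.chainLaw μ (chainSet 𝒜 A) n),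
      ∃ w : T →₀ ℝ, ∀ k : Fin (n + 1), x k = mass w (chainSet 𝒜 A k) := by
  classical
  have hU : IsSetChain 𝒜 (chainSet 𝒜 A) :=
    𝒜.isSetChain_chainSet fun i => hS.subset (hA.mem i)
  have hpos : 0 < n := by
    obtain ⟨j, -⟩ := hA.exists_eq hmin
    exact j.pos
  have h1 : ∀ᵐ x ∂(Q.chainLaw μ (chainSet 𝒜 A) n), ∀ i : Fin n,
      chainSet 𝒜 A (i + 1) = chainSet 𝒜 A i → x i.succ = x i.castSucc := by
    rw [ae_all_iff]
    intro i
    by_cases hi : chainSet 𝒜 A (i + 1) = chainSet 𝒜 A i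
    · simpa [hi] using Q.chainLaw_ae_succ_eq μ hU i hi
    · simp [hi]
  filter_upwards [h1] with x hx
  have hlv : ∀ i : Fin n, ¬ (leftNeighborhood S (A i)).Nonempty →
      TransitionSystem.leftValue x i = 0 := fun i hi => by
    have h0 : (i : ℕ) ≠ 0 := fun h => hi (leftNeighborhood_zero_nonempty hA hS h)
    have := hx i (chainSet_succ_of_leftNeighborhood_eq_empty hA
      (Set.not_nonempty_iff_eq_empty.1 hi))
    simp [TransitionSystem.leftValue, h0, this]
  let t₀ : T := Classical.arbitrary T
  -- One support point in each nonempty left neighbourhood. The default point is harmless because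
  -- the corresponding weight is zero by `hlv`.
  let p (i : Fin n) : T := if h : (leftNeighborhood S (A i)).Nonempty then h.some else t₀
  refine ⟨∑ i, Finsupp.single (p i) (TransitionSystem.leftValue x i), ?_⟩
  have hmass : ∀ D, mass (∑ i, Finsupp.single (p i) (TransitionSystem.leftValue x i)) D =
      ∑ i, TransitionSystem.leftValue x i * D.indicator 1 (p i) := fun D => by
    unfold mass
    rw [← Finsupp.sum_finsetSum_index (h := fun t c => c * D.indicator (1 : T → ℝ) t)
      (by simp) (by intros; ring)]
    exact Finset.sum_congr rfl fun i _ => by simp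
  have key : ∀ k : ℕ, ∀ hk : k < n, x ⟨k + 1, by omega⟩ =
      mass (∑ i, Finsupp.single (p i) (TransitionSystem.leftValue x i))
        (chainSet 𝒜 A (k + 1)) := fun k hk => by
    rw [hmass, ← sum_filter_leftValue x k hk, Finset.sum_filter]
    refine Finset.sum_congr rfl fun i _ => ?_
    by_cases hi : (leftNeighborhood S (A i)).Nonempty
    · have hpi : p i ∈ leftNeighborhood S (A i) := by
        simp only [p, hi, dif_pos]
        exact hi.some_mem
      simp [Set.indicator, mem_chainSet_iff_of_mem_leftNeighborhood hA hS hmin hpi k.succ_pos]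
    · simp [hlv i hi]
  intro k
  obtain ⟨k, hk⟩ := k
  -- Position `0` is separate because `leftValue` never involves `x 0` at the first set. As `A 0 =
  -- ∅'`, the chain does not grow in its first step, so `x 0 = x 1`.
  rcases k with _ | k
  · have h01 : chainSet 𝒜 A (0 + 1) = chainSet 𝒜 A 0 := by
      ext t
      simp only [mem_chainSet_iff]
      refine or_congr_right' fun ht => ⟨?_, fun ⟨j, hj, _⟩ => absurd hj (by omega)⟩
      rintro ⟨j, hj, htj⟩
      rw [hA.apply_zero hS hmin (by omega : (j : ℕ) = 0)] at htj
      exact absurd htj ht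
    have h := hx ⟨0, hpos⟩ h01
    have h2 := key 0 hpos
    rw [h01] at h2
    rw [← h2]
    exact h.symm
  · exact key k (by omega)

end Combinatorics

/-! ### Finite-dimensional distributions and their projectivity -/

section FiniteDimensional

variable {T : Type u} [TopologicalSpace T]

namespace IndexingCollection

/-- The nonempty intersections of members of `F` and `∅'`. -/
def generatedSemilattice (𝒜 : IndexingCollection T) (F : Set (Set T)) : Set (Set T) :=
  {A | A.Nonempty ∧ ∃ G ⊆ insert 𝒜.minSet F, G.Nonempty ∧ A = ⋂₀ G}

variable {𝒜 : IndexingCollection T} {F F' : Set (Set T)}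

theorem minSet_mem_generatedSemilattice [CompactSpace T] [Nonempty T] :
    𝒜.minSet ∈ 𝒜.generatedSemilattice F :=
  ⟨𝒜.minSet_nonempty, {𝒜.minSet}, by simp, Set.singleton_nonempty _, by simp⟩

theorem mem_generatedSemilattice {A : Set T} (hA : A ∈ F) (hne : A.Nonempty) :
    A ∈ 𝒜.generatedSemilattice F :=
  ⟨hne, {A}, by simp [hA], Set.singleton_nonempty _, by simp⟩

theorem generatedSemilattice_mono (h : F ⊆ F') :
    𝒜.generatedSemilattice F ⊆ 𝒜.generatedSemilattice F' :=
  fun _ ⟨hne, G, hG, hG'⟩ => ⟨hne, G, hG.trans (Set.insert_subset_insert h), hG'⟩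

theorem isFiniteSubsemilattice_generatedSemilattice [CompactSpace T] [Nonempty T]
    (hF : F.Finite) (hsub : F ⊆ 𝒜.sets) :
    𝒜.IsFiniteSubsemilattice (𝒜.generatedSemilattice F) where
  subset := by
    rintro _ ⟨-, G, hG, hne, rfl⟩
    exact 𝒜.sInter_mem G (hG.trans (Set.insert_subset 𝒜.minSet_mem hsub)) hne
  finite := by
    refine ((hF.insert 𝒜.minSet).finite_subsets.image (⋂₀ ·)).subset ?_
    rintro _ ⟨-, G, hG, -, rfl⟩
    exact ⟨G, hG, rfl⟩
  nonempty := ⟨_, minSet_mem_generatedSemilattice⟩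
  nonempty_of_mem A hA := hA.1
  inter_mem := by
    rintro _ ⟨hne, G, hG, hGne, rfl⟩ _ ⟨hne', G', hG', hGne', rfl⟩
    refine ⟨𝒜.inter_nonempty _ ?_ _ ?_ hne hne', G ∪ G', Set.union_subset hG hG', hGne.inl,
      (Set.sInter_union G G').symm⟩
    · exact 𝒜.sInter_mem G (hG.trans (Set.insert_subset 𝒜.minSet_mem hsub)) hGne
    · exact 𝒜.sInter_mem G' (hG'.trans (Set.insert_subset 𝒜.minSet_mem hsub)) hGne'

end IndexingCollection

variable {𝒜 : IndexingCollection T} {S S' : Set (Set T)} {n n' : ℕ} {A : Fin n → Set T}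
  {A' : Fin n' → Set T} {Q : TransitionSystem 𝒜} {μ : Measure ℝ} [IsProbabilityMeasure μ]

theorem IsConsistentOrdering.exists_perm {A' : Fin n → Set T} (hS : 𝒜.IsFiniteSubsemilattice S)
    (hmin : 𝒜.minSet ∈ S) (hA : IsConsistentOrdering S A) (hA' : IsConsistentOrdering S A') :
    ∃ π : Equiv.Perm (Fin n), (∀ i : Fin n, (i : ℕ) = 0 → π i = i) ∧ ∀ i, A i = A' (π i) := by
  have h i : ∃ j, A' j = A i := hA'.exists_eq (hA.mem i)
  choose π hπ using h
  have hinj : Function.Injective π := fun i j hij => hA.injective (by rw [← hπ, ← hπ, hij])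
  refine ⟨Equiv.ofBijective π (Finite.injective_iff_bijective.1 hinj), fun i hi => ?_,
    fun i => (hπ i).symm⟩
  exact hA'.injective (by
    rw [Equiv.ofBijective_apply, hπ, hA.apply_zero hS hmin hi, hA'.apply_zero hS hmin hi])

/-- The consistency assumption compares the left values on rectangles, a π-system, so it identifies
their joint laws up to the permutation `π`. The sum defining `orderingValue` does not see the order
of its terms. -/
theorem chainLaw_map_orderingValue_eq_of_same [CompactSpace T] [Nonempty T]
    (hQ : Q.Consistent μ) (hS : 𝒜.IsFiniteSubsemilattice S) (hmin : 𝒜.minSet ∈ S)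
    (hA : IsConsistentOrdering S A) (hA' : IsConsistentOrdering S A') {ι : Type*}
    (F : ι → Set T) :
    (Q.chainLaw μ (chainSet 𝒜 A) n).map (fun x i => orderingValue A x (F i)) =
      (Q.chainLaw μ (chainSet 𝒜 A') n').map (fun x i => orderingValue A' x (F i)) := by
  classical
  obtain rfl : n = n' := by
    have h1 := Set.ncard_image_of_injective Set.univ hA.injective
    have h2 := Set.ncard_image_of_injective Set.univ hA'.injective
    rw [Set.image_univ, hA.range_eq, Set.ncard_univ, Nat.card_fin] at h1
    rw [Set.image_univ, hA'.range_eq, Set.ncard_univ, Nat.card_fin] at h2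
    omega
  obtain ⟨π, hπ0, hπ⟩ := hA.exists_perm hS hmin hA'
  have := Q.isProbabilityMeasure_chainLaw μ (𝒜.isSetChain_chainSet fun i => hS.subset (hA.mem i)) n
  have := Q.isProbabilityMeasure_chainLaw μ
    (𝒜.isSetChain_chainSet fun i => hS.subset (hA'.mem i)) n
  have hm : Measurable fun (x : Fin (n + 1) → ℝ) i => TransitionSystem.leftValue x i :=
    measurable_pi_lambda _ fun i => measurable_leftValue i
  have hm' : Measurable fun (x : Fin (n + 1) → ℝ) i => TransitionSystem.leftValue x (π i) :=
    measurable_pi_lambda _ fun i => measurable_leftValue (π i)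
  have hlaw : (Q.chainLaw μ (chainSet 𝒜 A) n).map
      (fun x i => TransitionSystem.leftValue x i) =
      (Q.chainLaw μ (chainSet 𝒜 A') n).map (fun x i => TransitionSystem.leftValue x (π i)) := by
    have := Measure.isProbabilityMeasure_map (μ := Q.chainLaw μ (chainSet 𝒜 A) n) hm.aemeasurable
    have := Measure.isProbabilityMeasure_map (μ := Q.chainLaw μ (chainSet 𝒜 A') n) hm'.aemeasurable
    refine ext_of_generate_finite _ generateFrom_pi.symm isPiSystem_pi ?_ (by simp)
    rintro _ ⟨Γ, hΓ, rfl⟩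
    have hΓ' : ∀ i, MeasurableSet (Γ i) := fun i => hΓ i (Set.mem_univ i)
    rw [Measure.map_apply hm (.univ_pi hΓ'), Measure.map_apply hm' (.univ_pi hΓ')]
    simpa [Set.pi, Set.preimage] using
      hQ S hS n A A' hA hA' π hπ0 hπ Set.univ Γ MeasurableSet.univ hΓ'
  let G (l : Fin n → ℝ) (a : ι) : ℝ := ∑ i, if A i ⊆ F a then l i else 0
  have hG : Measurable G := measurable_pi_lambda _ fun a => Finset.measurable_sum _ fun i _ => by
    split_ifs <;> fun_prop
  calc _ = ((Q.chainLaw μ (chainSet 𝒜 A) n).map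
        (fun x i => TransitionSystem.leftValue x i)).map G := by
        rw [Measure.map_map hG hm]
        rfl
    _ = _ := by
        rw [hlaw, Measure.map_map hG hm']
        congr 1
        funext x a
        simp only [Function.comp_apply, G, orderingValue, hπ]
        exact Equiv.sum_comp π fun j =>
          if A' j ⊆ F a then TransitionSystem.leftValue x j else 0

/-- The law of the values determined by a consistent ordering of a finite sub-semilattice depends
neither on the ordering nor on the sub-semilattice. -/
theorem chainLaw_map_orderingValue_eq [CompactSpace T] [Nonempty T]
    (hQ : Q.Consistent μ) (hS : 𝒜.IsFiniteSubsemilattice S) (hS' : 𝒜.IsFiniteSubsemilattice S')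
    (hSS' : S ⊆ S') (hmin : 𝒜.minSet ∈ S)
    (hA : IsConsistentOrdering S A) (hA' : IsConsistentOrdering S' A') {ι : Type*} [Countable ι]
    {F : ι → Set T} (hF : ∀ i, F i ∈ S ∨ F i = ∅) :
    (Q.chainLaw μ (chainSet 𝒜 A) n).map (fun x i => orderingValue A x (F i)) =
      (Q.chainLaw μ (chainSet 𝒜 A') n').map (fun x i => orderingValue A' x (F i)) := by
  have hV := 𝒜.isSetChain_chainSet fun i => hS.subset (hA.mem i)
  obtain ⟨N, B, m, hB, hm⟩ := exists_isConsistentOrdering_adapted hS'.finite hV.mono n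
  have hU := 𝒜.isSetChain_chainSet fun i => hS'.subset (hB.mem i)
  rw [chainLaw_map_orderingValue_eq_of_same hQ hS' (hSS' hmin) hA' hB]
  -- The subchain must start at position `0`, whereas `m 0` counts the members inside `∅'` and so
  -- includes `∅'` itself. Both positions carry the same set.
  let M (k : Fin (n + 1)) : Fin (N + 1) :=
    if k = 0 then 0 else ⟨m k, Nat.lt_succ_iff.2 (hm k (Nat.lt_succ_iff.1 k.2)).1⟩
  have hM0 : M 0 = 0 := rfl
  have hMmono : Monotone M := fun k l hkl => by
    have hl := hm l (Nat.lt_succ_iff.1 l.2)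
    have hk := hm k (Nat.lt_succ_iff.1 k.2)
    by_cases hk0 : k = 0
    · simp [M, hk0]
    · have hl0 : l ≠ 0 := fun h => hk0 (Fin.le_zero_iff.1 (h ▸ hkl))
      simp only [M, hk0, hl0, if_false, Fin.mk_le_mk]
      by_contra! hlt
      have h1 := (hk.2 ⟨m l, by omega⟩).2 hlt
      exact lt_irrefl _ ((hl.2 ⟨m l, by omega⟩).1 (h1.trans (hV.mono hkl)))
  have hVU : ∀ k : Fin (n + 1), chainSet 𝒜 A k = chainSet 𝒜 B (M k) := fun k => by
    have hk := hm k (Nat.lt_succ_iff.1 k.2)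
    by_cases hk0 : k = 0
    · simp [hk0, hM0, chainSet]
    · simp only [M, hk0, if_false]
      refine Set.Subset.antisymm ?_ ?_
      · refine Set.union_subset (minSet_subset_chainSet _ _) (Set.iUnion₂_subset fun j hj => ?_)
        obtain ⟨i, hi⟩ := hB.exists_eq (hSS' (hA.mem j))
        rw [← hi]
        refine subset_chainSet B ((hk.2 i).1 ?_)
        rw [hi]
        exact subset_chainSet A hj
      · exact Set.union_subset (minSet_subset_chainSet _ _)
          (Set.iUnion₂_subset fun i hi => (hk.2 i).2 hi)
  have hmeas : Measurable fun (x : Fin (n + 1) → ℝ) (i : ι) => orderingValue A x (F i) :=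
    measurable_pi_lambda _ fun i => measurable_orderingValue A (F i)
  rw [← Q.chainLaw_map_comp μ hU n N M hMmono hM0 hVU, Measure.map_map hmeas
    (measurable_pi_lambda _ fun _ => measurable_pi_apply _)]
  refine Measure.map_congr ?_
  -- Once the path on the larger chain comes from a signed measure `w`, both recipes return the mass
  -- of `F i` under `w`.
  filter_upwards [chainLaw_ae_exists_mass Q μ hB hS' (hSS' hmin)] with x ⟨w, hw⟩
  funext i
  obtain rfl : x = fun k : Fin (N + 1) => mass w (chainSet 𝒜 B k) := funext hw
  rw [orderingValue_mass hB hS' (hSS' hmin) ((hF i).imp_left (hSS' ·)), Function.comp_apply,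
    ← orderingValue_mass hA hS hmin (hF i) w]
  congr 1
  funext k
  simp [hVU k]

/-- A process all of whose finite-dimensional distributions are given by consistent orderings. -/
def HasChainLaws (Q : TransitionSystem 𝒜) (μ : Measure ℝ) (P : Measure (𝒜.sets → ℝ)) : Prop :=
  ∀ (I : Finset 𝒜.sets) (n : ℕ) (A : Fin n → Set T),
    IsConsistentOrdering (𝒜.generatedSemilattice (Subtype.val '' (I : Set 𝒜.sets))) A →
    P.map I.restrict =
      (Q.chainLaw μ (chainSet 𝒜 A) n).map (fun x (a : I) => orderingValue A x (a : 𝒜.sets))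

theorem isFiniteSubsemilattice_of_finset [CompactSpace T] [Nonempty T] (I : Finset 𝒜.sets) :
    𝒜.IsFiniteSubsemilattice (𝒜.generatedSemilattice (Subtype.val '' (I : Set 𝒜.sets))) :=
  IndexingCollection.isFiniteSubsemilattice_generatedSemilattice (I.finite_toSet.image _)
    (by rintro _ ⟨a, -, rfl⟩; exact a.2)

theorem mem_generatedSemilattice_of_mem_finset {I : Finset 𝒜.sets} {a : 𝒜.sets} (ha : a ∈ I) :
    (a : Set T) ∈ 𝒜.generatedSemilattice (Subtype.val '' (I : Set 𝒜.sets)) ∨ (a : Set T) = ∅ := by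
  rcases Set.eq_empty_or_nonempty (a : Set T) with h | h
  · exact .inr h
  · exact .inl (IndexingCollection.mem_generatedSemilattice ⟨a, ha, rfl⟩ h)

/-- Passing from `I` to a subset `J` replaces the generated semilattice by a smaller one, which does
not change the law of the values on `J`; so the chosen laws are projective. -/
theorem exists_hasChainLaws [CompactSpace T] [Nonempty T] (hQ : Q.Consistent μ) :
    ∃ P : Measure (𝒜.sets → ℝ), IsProbabilityMeasure P ∧ HasChainLaws Q μ P := by
  have hex (I : Finset 𝒜.sets) := exists_isConsistentOrdering
    (isFiniteSubsemilattice_of_finset I).finite (fun _ => 0) monotone_const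
  choose n A hA _ using hex
  have hmeas (I : Finset 𝒜.sets) :
      Measurable fun x (a : I) => orderingValue (A I) x (a : 𝒜.sets) :=
    measurable_pi_lambda _ fun a => measurable_orderingValue _ _
  let P (I : Finset 𝒜.sets) : Measure (I → ℝ) :=
    (Q.chainLaw μ (chainSet 𝒜 (A I)) (n I)).map
      (fun x (a : I) => orderingValue (A I) x (a : 𝒜.sets))
  have hP (I) : IsProbabilityMeasure (P I) := by
    have := Q.isProbabilityMeasure_chainLaw μ
      (𝒜.isSetChain_chainSet fun i => (isFiniteSubsemilattice_of_finset I).subset ((hA I).mem i))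
        (n I)
    exact Measure.isProbabilityMeasure_map (hmeas I).aemeasurable
  have hproj : IsProjectiveMeasureFamily (α := fun _ => ℝ) P := by
    intro I J hJI
    have h : Measurable (Finset.restrict₂ (π := fun _ : 𝒜.sets => ℝ) hJI) :=
      Finset.measurable_restrict₂ _
    refine Eq.trans ?_ (Measure.map_map h (hmeas I)).symm
    exact chainLaw_map_orderingValue_eq hQ (isFiniteSubsemilattice_of_finset J)
      (isFiniteSubsemilattice_of_finset I)
      (IndexingCollection.generatedSemilattice_mono (Set.image_mono (by exact_mod_cast hJI)))
      IndexingCollection.minSet_mem_generatedSemilattice (hA J) (hA I)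
      (F := fun a : J => ((a : 𝒜.sets) : Set T))
      fun a => mem_generatedSemilattice_of_mem_finset a.2
  obtain ⟨ν, hν⟩ := exists_isProjectiveLimit_real hproj
  refine ⟨ν, hν.isProbabilityMeasure, fun I k B hB => ?_⟩
  rw [hν I]
  exact chainLaw_map_orderingValue_eq_of_same hQ (isFiniteSubsemilattice_of_finset I)
    IndexingCollection.minSet_mem_generatedSemilattice (hA I) hB _

end FiniteDimensional

/-! ### Additive extension to `𝒞(u)` and its uniqueness -/

section Extension

variable {T : Type u}

theorem iInter_mem_of_inter_mem {G : Set (Set T)} (hG : ∀ A ∈ G, ∀ B ∈ G, A ∩ B ∈ G) {ι : Type*}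
    {D : ι → Set T} {J : Finset ι} (hJ : J.Nonempty) (hD : ∀ i ∈ J, D i ∈ G) :
    ⋂ i ∈ J, D i ∈ G := by
  classical
  induction hJ using Finset.Nonempty.cons_induction with
  | singleton i => simpa using hD
  | cons i J hi hJ ih =>
    rw [Finset.cons_eq_insert, Finset.set_biInter_insert]
    exact hG _ (hD i (by simp)) _ (ih fun j hj => hD j (by simp [hj]))

theorem union_mem_finiteUnions {G : Set (Set T)} {A B : Set T} (hA : A ∈ finiteUnions G)
    (hB : B ∈ finiteUnions G) : A ∪ B ∈ finiteUnions G := by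
  obtain ⟨n, A, hA, rfl⟩ := hA
  obtain ⟨m, B, hB, rfl⟩ := hB
  rw [← Set.sUnion_range, ← Set.sUnion_range, ← Set.sUnion_union]
  refine sUnion_mem_finiteUnions ((Set.finite_range A).union (Set.finite_range B)) ?_
  rintro _ (⟨i, rfl⟩ | ⟨i, rfl⟩)
  exacts [hA i, hB i]

theorem indicator_iUnion_eq_sum {n : ℕ} (D : Fin n → Set T) :
    (⋃ i, D i).indicator (1 : T → ℝ) = ∑ J : Finset (Fin n) with J.Nonempty,
      (-1 : ℝ) ^ (J.card + 1) • (⋂ i ∈ J, D i).indicator (1 : T → ℝ) := by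
  funext t
  have h := Finset.indicator_biUnion_eq_sum_powerset Finset.univ D (1 : T → ℝ) t
  rw [Finset.powerset_univ] at h
  simp only [Finset.mem_univ, Set.iUnion_true] at h
  rw [h, Finset.sum_apply]
  refine Finset.sum_congr rfl fun J _ => ?_
  simp

theorem indicator_iUnion_mem {M : Submodule ℝ (T → ℝ)} {n : ℕ} {D : Fin n → Set T}
    (h : ∀ J : Finset (Fin n), J.Nonempty → (⋂ i ∈ J, D i).indicator 1 ∈ M) :
    (⋃ i, D i).indicator 1 ∈ M := by
  rw [indicator_iUnion_eq_sum]
  exact M.sum_mem fun J hJ => M.smul_mem _ (h J (Finset.mem_filter.1 hJ).2)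

theorem mass_eq_of_indicator_eq_sum {ι : Type*} {s : Finset ι} {c : ι → ℝ} {D : ι → Set T}
    {E : Set T} (h : E.indicator (1 : T → ℝ) = ∑ i ∈ s, c i • (D i).indicator (1 : T → ℝ))
    (w : T →₀ ℝ) : mass w E = ∑ i ∈ s, c i * mass w (D i) := by
  simp only [mass, Finsupp.sum, Finset.mul_sum]
  rw [Finset.sum_comm]
  refine Finset.sum_congr rfl fun t _ => ?_
  rw [h, Finset.sum_apply, Finset.mul_sum]
  refine Finset.sum_congr rfl fun i _ => ?_
  simp only [Pi.smul_apply, smul_eq_mul]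
  ring

theorem inclExcl_ae_congr {Ω : Type u} [MeasurableSpace Ω] {P : Measure Ω}
    {Y Y' : Set T → Ω → ℝ} {n : ℕ} {D : Fin n → Set T}
    (h : ∀ J : Finset (Fin n), J.Nonempty → Y (⋂ i ∈ J, D i) =ᵐ[P] Y' (⋂ i ∈ J, D i)) :
    inclExcl Y D =ᵐ[P] inclExcl Y' D := by
  have hall : ∀ᵐ ω ∂P, ∀ J : Finset (Fin n), J.Nonempty →
      Y (⋂ i ∈ J, D i) ω = Y' (⋂ i ∈ J, D i) ω := by
    rw [ae_all_iff]
    intro J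
    by_cases hJ : J.Nonempty
    · filter_upwards [h J hJ] with ω hω _ using hω
    · simp [hJ]
  filter_upwards [hall] with ω hω
  exact Finset.sum_congr rfl fun J hJ => by rw [hω J (Finset.mem_filter.1 hJ).2]

variable [TopologicalSpace T]

namespace IndexingCollection

variable (𝒜 : IndexingCollection T)

theorem mem_C_of_mem {A : Set T} (hA : A ∈ 𝒜.sets) : A ∈ 𝒜.C :=
  ⟨A, hA, ∅, ⟨0, Fin.elim0, fun i => i.elim0, by simp⟩, by simp⟩

theorem inter_mem_C (D : Set T) (hD : D ∈ 𝒜.C) (E : Set T) (hE : E ∈ 𝒜.C) : D ∩ E ∈ 𝒜.C := by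
  obtain ⟨A, hA, B, hB, rfl⟩ := hD
  obtain ⟨A', hA', B', hB', rfl⟩ := hE
  exact ⟨A ∩ A', 𝒜.inter_mem hA hA', B ∪ B', union_mem_finiteUnions hB hB', by
    ext; simp; tauto⟩

theorem iInter_mem {ι : Type*} {D : ι → Set T} {J : Finset ι} (hJ : J.Nonempty)
    (hD : ∀ i ∈ J, D i ∈ 𝒜.sets) : ⋂ i ∈ J, D i ∈ 𝒜.sets :=
  iInter_mem_of_inter_mem (fun _ hA _ hB => 𝒜.inter_mem hA hB) hJ hD

/-- Linear combinations of indicators of members of `𝒜`. -/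
noncomputable def indicatorCombination : (𝒜.sets →₀ ℝ) →ₗ[ℝ] (T → ℝ) :=
  Finsupp.linearCombination ℝ fun a : 𝒜.sets => (a : Set T).indicator 1

/-- Linear combinations of coordinates of a process indexed by `𝒜`. -/
noncomputable def coordinateCombination : (𝒜.sets →₀ ℝ) →ₗ[ℝ] ((𝒜.sets → ℝ) → ℝ) :=
  Finsupp.linearCombination ℝ fun a ω => ω a

theorem indicatorCombination_single (a : 𝒜.sets) :
    𝒜.indicatorCombination (Finsupp.single a 1) = (a : Set T).indicator 1 := by
  simp [indicatorCombination]

theorem indicator_mem_range {A : Set T} (hA : A ∈ 𝒜.sets) :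
    A.indicator 1 ∈ LinearMap.range 𝒜.indicatorCombination :=
  ⟨_, 𝒜.indicatorCombination_single ⟨A, hA⟩⟩

/-- Write `1_{A \ B} = 1_A - 1_{A ∩ B}` and expand the union `A ∩ B` by inclusion–exclusion; the
intersections stay in `𝒜`. -/
theorem indicator_mem_range_of_mem_C {D : Set T} (hD : D ∈ 𝒜.C) :
    D.indicator 1 ∈ LinearMap.range 𝒜.indicatorCombination := by
  obtain ⟨A, hA, _, ⟨n, B, hB, rfl⟩, rfl⟩ := hD
  have h : (A \ ⋃ i, B i).indicator (1 : T → ℝ) =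
      A.indicator 1 - (⋃ i, A ∩ B i).indicator 1 := by
    rw [← Set.inter_iUnion]
    funext t
    by_cases h1 : t ∈ A <;> by_cases h2 : t ∈ ⋃ i, B i <;> simp only [Set.indicator, Pi.sub_apply,
      Set.mem_sdiff, Set.mem_inter_iff, h1, h2] <;> simp
  rw [h]
  exact Submodule.sub_mem _ (𝒜.indicator_mem_range hA) (indicator_iUnion_mem fun J hJ =>
    𝒜.indicator_mem_range (𝒜.iInter_mem hJ fun i _ => 𝒜.inter_mem hA (hB i)))

/-- The indicator of a set of `𝒜(u)` is a combination of indicators of smaller members of `𝒜`. -/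
theorem exists_indicatorCombination_eq_of_mem_Au {B : Set T} (hB : B ∈ 𝒜.Au) :
    ∃ f, 𝒜.indicatorCombination f = B.indicator 1 ∧ ∀ a ∈ f.support, (a : Set T) ⊆ B := by
  obtain ⟨n, A, hA, rfl⟩ := hB
  have h : (⋃ i, A i).indicator 1 ∈ (Finsupp.supported ℝ ℝ
      {a : 𝒜.sets | (a : Set T) ⊆ ⋃ i, A i}).map 𝒜.indicatorCombination := by
    refine indicator_iUnion_mem fun J hJ => ?_
    refine ⟨_, Finsupp.single_mem_supported ℝ _ ?_,
      𝒜.indicatorCombination_single ⟨_, 𝒜.iInter_mem hJ fun i _ => hA i⟩⟩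
    obtain ⟨i, hi⟩ := hJ
    exact (Set.biInter_subset_of_mem hi).trans (Set.subset_iUnion A i)
  obtain ⟨f, hf, hfB⟩ := h
  exact ⟨f, hfB, fun a ha => hf ha⟩

open Classical in
/-- The linear extension of the coordinate process to sets whose indicator is a combination of
indicators of members of `𝒜`. -/
noncomputable def coordinateExtension (D : Set T) : (𝒜.sets → ℝ) → ℝ :=
  if h : ∃ f, 𝒜.indicatorCombination f = D.indicator 1 then 𝒜.coordinateCombination h.choose else 0

end IndexingCollection

variable {𝒜 : IndexingCollection T} {Q : TransitionSystem 𝒜} {μ : Measure ℝ}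
  [IsProbabilityMeasure μ] {P : Measure (𝒜.sets → ℝ)}

/-- The finitely many coordinates involved are almost surely the masses of a signed measure, and
masses satisfy every linear relation that indicators satisfy. -/
theorem HasChainLaws.ae_coordinateCombination_eq_zero [CompactSpace T] [Nonempty T]
    (hP : HasChainLaws Q μ P) {f : 𝒜.sets →₀ ℝ} (hf : 𝒜.indicatorCombination f = 0) :
    𝒜.coordinateCombination f =ᵐ[P] 0 := by
  have hS := isFiniteSubsemilattice_of_finset f.support
  obtain ⟨n, A, hA, -⟩ := exists_isConsistentOrdering hS.finite (fun _ => 0) monotone_const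
  have hmeas : Measurable fun x (a : f.support) => orderingValue A x (a : 𝒜.sets) :=
    measurable_pi_lambda _ fun a => measurable_orderingValue _ _
  have hset : MeasurableSet {y : f.support → ℝ | ∑ a : f.support, f a * y a = 0} :=
    measurableSet_eq_fun (by fun_prop) (by fun_prop)
  have h : ∀ᵐ y ∂(P.map f.support.restrict), ∑ a : f.support, f a * y a = 0 := by
    rw [hP _ n A hA, ae_map_iff hmeas.aemeasurable hset]
    have hmin := IndexingCollection.minSet_mem_generatedSemilattice (𝒜 := 𝒜)
      (F := Subtype.val '' (f.support : Set 𝒜.sets))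
    filter_upwards [chainLaw_ae_exists_mass Q μ hA hS hmin] with x ⟨w, hw⟩
    obtain rfl : x = fun k : Fin (n + 1) => mass w (chainSet 𝒜 A k) := funext hw
    -- The zero function is written as the indicator of `∅`, whose mass is zero.
    have h0 : (∅ : Set T).indicator (1 : T → ℝ) =
        ∑ a : f.support, f a • ((a : 𝒜.sets) : Set T).indicator (1 : T → ℝ) := by
      rw [Set.indicator_empty', ← hf, IndexingCollection.indicatorCombination,
        Finsupp.linearCombination_apply, Finsupp.sum, ← Finset.sum_coe_sort]
    have h1 := mass_eq_of_indicator_eq_sum h0 w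
    have h2 : mass w ∅ = 0 := by simp [mass]
    rw [h2] at h1
    rw [h1]
    refine Finset.sum_congr rfl fun a _ => ?_
    rw [orderingValue_mass hA hS hmin (mem_generatedSemilattice_of_mem_finset a.2)]
  filter_upwards [ae_of_ae_map (Finset.measurable_restrict _).aemeasurable h] with ω hω
  rw [IndexingCollection.coordinateCombination, Finsupp.linearCombination_apply, Finsupp.sum,
    Finset.sum_apply, ← Finset.sum_coe_sort]
  exact hω

/-- Two representations of one indicator differ by a combination that vanishes, so the arbitrary
choice in `coordinateExtension` matters only on a null set. -/
theorem HasChainLaws.coordinateExtension_ae_eq [CompactSpace T] [Nonempty T]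
    (hP : HasChainLaws Q μ P) {f : 𝒜.sets →₀ ℝ} {D : Set T}
    (hf : 𝒜.indicatorCombination f = D.indicator 1) :
    𝒜.coordinateExtension D =ᵐ[P] 𝒜.coordinateCombination f := by
  have h : ∃ f, 𝒜.indicatorCombination f = D.indicator 1 := ⟨f, hf⟩
  rw [IndexingCollection.coordinateExtension, dif_pos h]
  have h0 := hP.ae_coordinateCombination_eq_zero (f := h.choose - f)
    (by rw [map_sub, h.choose_spec, hf, sub_self])
  filter_upwards [h0] with ω hω
  rw [map_sub] at hω
  exact sub_eq_zero.1 hω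

theorem HasChainLaws.isAdditiveExtension [CompactSpace T] [Nonempty T]
    (hP : HasChainLaws Q μ P) :
    IsAdditiveExtension P (fun (a : 𝒜.sets) ω => ω a) 𝒜.coordinateExtension := by
  refine ⟨fun a => ?_, fun n D hD => ?_⟩
  · filter_upwards [hP.coordinateExtension_ae_eq (𝒜.indicatorCombination_single a)] with ω hω
    simp [hω, IndexingCollection.coordinateCombination]
  · have hex : ∀ J : Finset (Fin n), ∃ f, J.Nonempty →
        𝒜.indicatorCombination f = (⋂ i ∈ J, D i).indicator 1 := fun J => by
      by_cases hJ : J.Nonempty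
      · obtain ⟨f, hf⟩ := 𝒜.indicator_mem_range_of_mem_C
          (iInter_mem_of_inter_mem 𝒜.inter_mem_C hJ fun i _ => hD i)
        exact ⟨f, fun _ => hf⟩
      · exact ⟨0, fun h => absurd h hJ⟩
    choose f hf using hex
    have hU : 𝒜.indicatorCombination (∑ J : Finset (Fin n) with J.Nonempty,
        (-1 : ℝ) ^ (J.card + 1) • f J) = (⋃ i, D i).indicator 1 := by
      rw [indicator_iUnion_eq_sum, map_sum]
      refine Finset.sum_congr rfl fun J hJ => ?_
      rw [map_smul, hf J (Finset.mem_filter.1 hJ).2]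
    have hall : ∀ᵐ ω ∂P, ∀ J : Finset (Fin n), J.Nonempty →
        𝒜.coordinateExtension (⋂ i ∈ J, D i) ω = 𝒜.coordinateCombination (f J) ω := by
      rw [ae_all_iff]
      intro J
      by_cases hJ : J.Nonempty
      · filter_upwards [hP.coordinateExtension_ae_eq (hf J hJ)] with ω hω _ using hω
      · simp [hJ]
    filter_upwards [hP.coordinateExtension_ae_eq hU, hall] with ω h1 h2
    rw [h1, map_sum, Finset.sum_apply, inclExcl]
    refine Finset.sum_congr rfl fun J hJ => ?_
    rw [map_smul, h2 J (Finset.mem_filter.1 hJ).2]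
    rfl

variable {Ω : Type u} [MeasurableSpace Ω] {P : Measure Ω} {X : 𝒜.sets → Ω → ℝ}
  {Y Y' : Set T → Ω → ℝ}

theorem IsAdditiveExtension.ae_eq_of_mem (hY : IsAdditiveExtension P X Y)
    (hY' : IsAdditiveExtension P X Y') {A : Set T} (hA : A ∈ 𝒜.sets) : Y A =ᵐ[P] Y' A :=
  (hY.1 ⟨A, hA⟩).trans (hY'.1 ⟨A, hA⟩).symm

theorem IsAdditiveExtension.ae_eq_of_mem_C (hY : IsAdditiveExtension P X Y)
    (hY' : IsAdditiveExtension P X Y') {D : Set T} (hD : D ∈ 𝒜.C) : Y D =ᵐ[P] Y' D := by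
  classical
  obtain ⟨A, hA, _, ⟨n, B, hB, rfl⟩, rfl⟩ := hD
  -- `A` is decomposed into the set in question, at index `0`, and the pieces `A ∩ B i`.
  -- Intersections other than the singleton `{0}` are either empty or in `𝒜`, where both extensions
  -- agree with `X`. In the inclusion–exclusion formula for `A` the only unknown is then the value
  -- at `E 0`.
  let E : Fin (n + 1) → Set T := Fin.cons (A \ ⋃ i, B i) fun i => A ∩ B i
  have hE : ∀ i, E i ∈ 𝒜.C := by
    refine Fin.cases ?_ fun i => ?_
    · exact ⟨A, hA, _, ⟨n, B, hB, rfl⟩, rfl⟩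
    · exact 𝒜.mem_C_of_mem (𝒜.inter_mem hA (hB i))
  have hEA : ⋃ i, E i = A := by
    ext t
    simp only [E, Set.mem_iUnion, Fin.exists_fin_succ, Fin.cons_zero, Fin.cons_succ, Set.mem_sdiff,
      Set.mem_inter_iff]
    by_cases h : ∃ i, t ∈ B i
    · simp [h]
    · simp only [h, not_false_eq_true, and_true, or_iff_left_iff_imp, forall_exists_index]
      exact fun i hi => hi.1
  have hJ : ∀ J : Finset (Fin (n + 1)), J.Nonempty → J ≠ {0} → ⋂ i ∈ J, E i ∈ 𝒜.sets := by
    intro J hJ hJ0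
    by_cases h0 : 0 ∈ J
    · obtain ⟨j, hj, hj0⟩ : ∃ j ∈ J, j ≠ 0 := by
        by_contra! h
        exact hJ0 (Finset.eq_singleton_iff_unique_mem.2 ⟨h0, h⟩)
      obtain ⟨i, rfl⟩ := Fin.exists_succ_eq.2 hj0
      have : ⋂ i ∈ J, E i = ∅ := by
        refine Set.eq_empty_of_forall_notMem fun t ht => ?_
        have h1 := Set.mem_iInter₂.1 ht 0 h0
        have h2 := Set.mem_iInter₂.1 ht _ hj
        exact h1.2 (Set.mem_iUnion.2 ⟨i, h2.2⟩)
      rw [this]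
      exact 𝒜.empty_mem
    · refine 𝒜.iInter_mem hJ fun j hj => ?_
      obtain ⟨i, rfl⟩ := Fin.exists_succ_eq.2 fun h => h0 (h ▸ hj)
      exact 𝒜.inter_mem hA (hB i)
  have hall : ∀ᵐ ω ∂P, ∀ J : Finset (Fin (n + 1)), J.Nonempty → J ≠ {0} →
      Y (⋂ i ∈ J, E i) ω = Y' (⋂ i ∈ J, E i) ω := by
    rw [ae_all_iff]
    intro J
    by_cases h : J.Nonempty ∧ J ≠ {0}
    · filter_upwards [hY.ae_eq_of_mem hY' (hJ J h.1 h.2)] with ω hω _ _ using hω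
    · exact Filter.Eventually.of_forall fun ω h1 h2 => absurd ⟨h1, h2⟩ h
  have h0 : ({0} : Finset (Fin (n + 1))) ∈ Finset.univ.filter Finset.Nonempty := by simp
  filter_upwards [hall, hY.2 _ E hE, hY'.2 _ E hE, hY.ae_eq_of_mem hY' hA] with ω h1 h2 h3 h4
  rw [hEA] at h2 h3
  rw [h2, h3, inclExcl, inclExcl, ← Finset.add_sum_erase _ _ h0, ← Finset.add_sum_erase _ _ h0,
    Finset.sum_congr rfl fun J hJ => by
      rw [h1 J (Finset.mem_filter.1 (Finset.mem_erase.1 hJ).2).2 (Finset.mem_erase.1 hJ).1]] at h4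
  rw [add_left_inj] at h4
  simpa [E] using h4

theorem IsAdditiveExtension.ae_eq (hY : IsAdditiveExtension P X Y)
    (hY' : IsAdditiveExtension P X Y') {D : Set T} (hD : D ∈ 𝒜.Cu) : Y D =ᵐ[P] Y' D := by
  obtain ⟨n, E, hE, rfl⟩ := hD
  exact (hY.2 n E hE).trans ((inclExcl_ae_congr fun J hJ => hY.ae_eq_of_mem_C hY'
    (iInter_mem_of_inter_mem 𝒜.inter_mem_C hJ fun i _ => hE i)).trans (hY'.2 n E hE).symm)

end Extension

/-! ### The Markov property and the initial law -/

section Markov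

variable {T : Type u} [TopologicalSpace T]
  {𝒜 : IndexingCollection T} {Q : TransitionSystem 𝒜} {μ : Measure ℝ}
  [IsProbabilityMeasure μ] {P : Measure (𝒜.sets → ℝ)}

theorem IndexingCollection.coordinateCombination_apply (f : 𝒜.sets →₀ ℝ) (ω : 𝒜.sets → ℝ) :
    𝒜.coordinateCombination f ω = ∑ a ∈ f.support, f a * ω a := by
  rw [coordinateCombination, Finsupp.linearCombination_apply, Finsupp.sum, Finset.sum_apply]
  rfl

theorem IndexingCollection.measurable_coordinateCombination (f : 𝒜.sets →₀ ℝ) :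
    Measurable (𝒜.coordinateCombination f) := by
  have : 𝒜.coordinateCombination f = fun ω => ∑ a ∈ f.support, f a * ω a :=
    funext (𝒜.coordinateCombination_apply f)
  rw [this]
  fun_prop

theorem mass_eq_of_indicatorCombination {f : 𝒜.sets →₀ ℝ} {B : Set T}
    (hf : 𝒜.indicatorCombination f = B.indicator 1) (w : T →₀ ℝ) :
    mass w B = ∑ a ∈ f.support, f a * mass w (a : 𝒜.sets) :=
  mass_eq_of_indicator_eq_sum (by
    rw [← hf, IndexingCollection.indicatorCombination, Finsupp.linearCombination_apply]
    rfl) w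

theorem chainSet_eq_of_iff {n m : ℕ} {A : Fin n → Set T} {B : Set T} (hB : 𝒜.minSet ⊆ B)
    (hm : ∀ i, A i ⊆ B ↔ (i : ℕ) < m) (hcover : ∀ t ∈ B, ∃ i, A i ⊆ B ∧ t ∈ A i) :
    chainSet 𝒜 A m = B := by
  refine Set.Subset.antisymm (Set.union_subset hB (Set.iUnion₂_subset fun i hi => (hm i).2 hi)) ?_
  intro t ht
  obtain ⟨i, hi, hti⟩ := hcover t ht
  exact subset_chainSet A ((hm i).1 hi) hti

theorem history_eq_comap (B : Set T) :
    history (fun (a : 𝒜.sets) (ω : 𝒜.sets → ℝ) => ω a) B =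
      MeasurableSpace.comap
        (fun (ω : 𝒜.sets → ℝ) (a : {a : 𝒜.sets // (a : Set T) ⊆ B}) => ω a) MeasurableSpace.pi := by
  simp only [history, MeasurableSpace.pi, MeasurableSpace.comap_iSup, MeasurableSpace.comap_comp,
    iSup_subtype]
  rfl

variable [CompactSpace T] [Nonempty T]

/-- The joint law of finitely many values in the past of `B`, of the value at `B` and of the value
at `B'`. -/
theorem HasChainLaws.map_eq_compProd [IsProbabilityMeasure P] (hP : HasChainLaws Q μ P)
    {B B' : Set T} (hB : B ∈ 𝒜.Au) (hB' : B' ∈ 𝒜.Au) (hne : B.Nonempty) (hBB' : B ⊆ B')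
    {f f' : 𝒜.sets →₀ ℝ} (hf : 𝒜.indicatorCombination f = B.indicator 1)
    (hf' : 𝒜.indicatorCombination f' = B'.indicator 1) {ι : Type*} [Fintype ι]
    {F : ι → 𝒜.sets} (hF : ∀ i, (F i : Set T) ⊆ B) :
    P.map (fun ω => ((fun i => ω (F i), 𝒜.coordinateCombination f ω),
        𝒜.coordinateCombination f' ω)) =
      P.map (fun ω => (fun i => ω (F i), 𝒜.coordinateCombination f ω)) ⊗ₘ
        (Q.kernel B B').comap Prod.snd measurable_snd := by
  classical
  have hmf := 𝒜.measurable_coordinateCombination f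
  have hmf' := 𝒜.measurable_coordinateCombination f'
  have := Q.isMarkovKernel B hB B' hB' hne hBB'
  -- It is enough to realise the triple on a path whose last coordinate is the value at `B`. The
  -- kernel uses only that coordinate, and the first marginal then identifies the law of the past.
  suffices h : ∃ (m : ℕ) (ν : Measure (Fin (m + 1) → ℝ)) (_ : IsProbabilityMeasure ν)
      (g : (Fin (m + 1) → ℝ) → ι → ℝ), Measurable g ∧
      P.map (fun ω => ((fun i => ω (F i), 𝒜.coordinateCombination f ω),
        𝒜.coordinateCombination f' ω)) =
      (ν ⊗ₘ Q.lastKernel B B' m).map (Prod.map (fun r => (g r, r (Fin.last m))) id) by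
    obtain ⟨m, ν, _, g, hg, h⟩ := h
    have h1 := Measure.map_prodMap_compProd_comap ν ((Q.kernel B B').comap
      (Prod.snd : (ι → ℝ) × ℝ → ℝ) measurable_snd)
      (g := fun r => (g r, r (Fin.last m))) (by fun_prop)
    have h2 : P.map (fun ω => ((fun i => ω (F i), 𝒜.coordinateCombination f ω),
        𝒜.coordinateCombination f' ω)) = ν.map (fun r => (g r, r (Fin.last m))) ⊗ₘ
        (Q.kernel B B').comap Prod.snd measurable_snd := h.trans h1
    have := Measure.isProbabilityMeasure_map (μ := ν) (f := fun r => (g r, r (Fin.last m)))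
      (by fun_prop)
    have h3 := congrArg Measure.fst h2
    rw [Measure.fst_compProd, Measure.fst, Measure.map_map measurable_fst (by fun_prop)] at h3
    rw [h2, ← h3]
    rfl
  have hminB := 𝒜.minSet_subset_of_mem_Au hB hne
  obtain ⟨p, b, hb, hbB⟩ := id hB
  obtain ⟨q, b', hb', hbB'⟩ := id hB'
  -- Besides all coordinates occurring in the statement, the constituents of `B` and `B'` are
  -- included, so that an adapted chain passes through exactly these two sets.
  let I : Finset 𝒜.sets := Finset.univ.image F ∪ f.support ∪ f'.support ∪
    Finset.univ.image (fun i => (⟨b i, hb i⟩ : 𝒜.sets)) ∪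
    Finset.univ.image (fun i => (⟨b' i, hb' i⟩ : 𝒜.sets))
  have hIF i : F i ∈ I := by simp [I]
  have hIf : f.support ⊆ I := fun a ha => by simp only [I, Finset.mem_union, ha]; tauto
  have hIf' : f'.support ⊆ I := fun a ha => by simp only [I, Finset.mem_union, ha]; tauto
  have hIb i : (⟨b i, hb i⟩ : 𝒜.sets) ∈ I := by simp [I]
  have hIb' i : (⟨b' i, hb' i⟩ : 𝒜.sets) ∈ I := by simp [I]
  have hS := isFiniteSubsemilattice_of_finset I
  have hmin := IndexingCollection.minSet_mem_generatedSemilattice (𝒜 := 𝒜)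
      (F := Subtype.val '' (I : Set 𝒜.sets))
  let V (k : ℕ) : Set T := if k = 0 then B else B'
  have hV : Monotone V := monotone_nat_of_le_succ fun k => by
    rcases k with _ | k
    · simpa [V] using hBB'
    · simp [V]
  obtain ⟨n, A, m, hA, hm⟩ := exists_isConsistentOrdering_adapted hS.finite hV 1
  obtain ⟨hm0n, hm0⟩ := hm 0 zero_le_one
  obtain ⟨hm1n, hm1⟩ := hm 1 le_rfl
  have hm01 : m 0 ≤ m 1 := by
    by_contra! hlt
    have := (hm0 ⟨m 1, by omega⟩).2 hlt
    exact lt_irrefl _ ((hm1 ⟨m 1, by omega⟩).1 (this.trans (hV zero_le_one)))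
  simp only [V, if_true, one_ne_zero, if_false] at hm0 hm1
  have hU := 𝒜.isSetChain_chainSet fun i => hS.subset (hA.mem i)
  have hUB : chainSet 𝒜 A (m 0) = B := by
    refine chainSet_eq_of_iff hminB hm0 fun t ht => ?_
    obtain ⟨i, hi⟩ := Set.mem_iUnion.1 (hbB ▸ ht)
    obtain ⟨l, hl⟩ := hA.exists_eq (IndexingCollection.mem_generatedSemilattice (𝒜 := 𝒜)
      ⟨_, hIb i, rfl⟩ ⟨t, hi⟩)
    exact ⟨l, by rw [hl, hbB]; exact Set.subset_iUnion b i, by rw [hl]; exact hi⟩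
  have hUB' : chainSet 𝒜 A (m 1) = B' := by
    refine chainSet_eq_of_iff (hminB.trans hBB') hm1 fun t ht => ?_
    obtain ⟨i, hi⟩ := Set.mem_iUnion.1 (hbB' ▸ ht)
    obtain ⟨l, hl⟩ := hA.exists_eq (IndexingCollection.mem_generatedSemilattice (𝒜 := 𝒜)
      ⟨_, hIb' i, rfl⟩ ⟨t, hi⟩)
    exact ⟨l, by rw [hl, hbB']; exact Set.subset_iUnion b' i, by rw [hl]; exact hi⟩
  -- Zero padding turns an initial path into a full one; sets inside `B` lie before position `m 0`,
  -- so their values do not involve the padding.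
  let ext (r : Fin (m 0 + 1) → ℝ) (k : Fin (n + 1)) : ℝ :=
    if h : (k : ℕ) < m 0 + 1 then r ⟨k, h⟩ else 0
  have hext : Measurable ext := measurable_pi_lambda _ fun k => by
    by_cases h : (k : ℕ) < m 0 + 1
    · simpa only [ext, h, dif_pos] using measurable_pi_apply _
    · simpa only [ext, h, dif_neg, not_false_eq_true] using measurable_const
  let g (r : Fin (m 0 + 1) → ℝ) (i : ι) : ℝ := orderingValue A (ext r) (F i)
  have hg : Measurable g :=
    measurable_pi_lambda _ fun i => (measurable_orderingValue A (F i)).comp hext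
  refine ⟨m 0, Q.chainLaw μ (chainSet 𝒜 A) (m 0), Q.isProbabilityMeasure_chainLaw μ hU _, g, hg, ?_⟩
  let Ψ (y : I → ℝ) : ((ι → ℝ) × ℝ) × ℝ := ((fun i => y ⟨F i, hIF i⟩,
    ∑ a : f.support, f a * y ⟨a, hIf a.2⟩), ∑ a : f'.support, f' a * y ⟨a, hIf' a.2⟩)
  have hΨ : Measurable Ψ := by fun_prop
  have hval : Measurable fun x (a : I) => orderingValue A x (a : 𝒜.sets) :=
    measurable_pi_lambda _ fun a => measurable_orderingValue _ _
  have hgl : Measurable fun r : Fin (m 0 + 1) → ℝ => (g r, r (Fin.last (m 0))) := by fun_prop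
  calc P.map (fun ω => ((fun i => ω (F i), 𝒜.coordinateCombination f ω),
        𝒜.coordinateCombination f' ω))
      = (P.map I.restrict).map Ψ := by
        rw [Measure.map_map hΨ (Finset.measurable_restrict _)]
        congr 1
        funext ω
        simp only [IndexingCollection.coordinateCombination_apply, Function.comp_apply, Ψ,
          Finset.restrict]
        rw [← Finset.sum_coe_sort f.support (fun a => f a * ω a),
          ← Finset.sum_coe_sort f'.support (fun a => f' a * ω a)]
    _ = (Q.chainLaw μ (chainSet 𝒜 A) n).map
        (fun x => Ψ fun a : I => orderingValue A x (a : 𝒜.sets)) := by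
        rw [hP I n A hA, Measure.map_map hΨ hval]
        rfl
    _ = (Q.chainLaw μ (chainSet 𝒜 A) n).map
        ((Prod.map (fun r => (g r, r (Fin.last (m 0)))) id ∘
          fun x : Fin (m 1 + 1) → ℝ => ((fun i : Fin (m 0 + 1) => x (Fin.castLE (by omega) i)),
            x (Fin.last (m 1)))) ∘
          fun x (i : Fin (m 1 + 1)) => x (Fin.castLE (by omega) i)) := by
        refine Measure.map_congr ?_
        filter_upwards [chainLaw_ae_exists_mass Q μ hA hS hmin] with x ⟨w, hw⟩
        have hv : ∀ a ∈ I, orderingValue A x (a : 𝒜.sets) = mass w a := fun a ha => by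
          obtain rfl : x = fun k : Fin (n + 1) => mass w (chainSet 𝒜 A k) := funext hw
          exact orderingValue_mass hA hS hmin (mem_generatedSemilattice_of_mem_finset ha) w
        refine Prod.ext (Prod.ext (funext fun i => ?_) ?_) ?_
        · simp only [Ψ, Function.comp_apply, Prod.map_apply, g]
          rw [← orderingValue_extend (m := m 0) (fun j hj => (hm0 j).1 (hj.trans (hF i))) x]
          congr 1
        · simp only [Ψ, Function.comp_apply, Prod.map_apply]
          have h1 := hw ⟨m 0, by omega⟩
          rw [hUB, mass_eq_of_indicatorCombination hf w, ← Finset.sum_coe_sort] at h1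
          refine Eq.trans ?_ h1.symm
          exact Finset.sum_congr rfl fun a _ => by rw [hv a (hIf a.2)]
        · simp only [Ψ, Function.comp_apply, Prod.map_apply]
          have h1 := hw ⟨m 1, by omega⟩
          rw [hUB', mass_eq_of_indicatorCombination hf' w, ← Finset.sum_coe_sort] at h1
          refine Eq.trans ?_ h1.symm
          exact Finset.sum_congr rfl fun a _ => by rw [hv a (hIf' a.2)]
    _ = _ := by
        have hr : Measurable fun (x : Fin (n + 1) → ℝ) (i : Fin (m 1 + 1)) =>
          x (Fin.castLE (by omega) i) := measurable_pi_lambda _ fun _ => measurable_pi_apply _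
        rw [← Measure.map_map ((hgl.prodMap measurable_id).comp (by fun_prop)) hr, Q.chainLaw_map_castLE μ hU hm1n,
          ← Measure.map_map (hgl.prodMap measurable_id) (by fun_prop),
          Q.chainLaw_map_castLE_last μ hU hm01, hUB, hUB']

/-- Both sides, as functions of `s`, are measures on the coordinates indexed by subsets of `B`.
Their finite-dimensional marginals agree by `map_eq_compProd`, so they coincide as projective limits
of one finite family. -/
theorem HasChainLaws.setLIntegral_kernel [IsProbabilityMeasure P] (hP : HasChainLaws Q μ P)
    {B B' : Set T} (hB : B ∈ 𝒜.Au) (hB' : B' ∈ 𝒜.Au) (hne : B.Nonempty) (hBB' : B ⊆ B')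
    {f f' : 𝒜.sets →₀ ℝ} (hf : 𝒜.indicatorCombination f = B.indicator 1)
    (hf' : 𝒜.indicatorCombination f' = B'.indicator 1) {Γ : Set ℝ} (hΓ : MeasurableSet Γ)
    {s : Set (𝒜.sets → ℝ)}
    (hs : MeasurableSet[history (fun (a : 𝒜.sets) (ω : 𝒜.sets → ℝ) => ω a) B] s) :
    ∫⁻ ω in s, Q.kernel B B' (𝒜.coordinateCombination f ω) Γ ∂P =
      P (s ∩ 𝒜.coordinateCombination f' ⁻¹' Γ) := by
  have hmf := 𝒜.measurable_coordinateCombination f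
  have hmf' := 𝒜.measurable_coordinateCombination f'
  have hker := Q.isMarkovKernel B hB B' hB' hne hBB'
  let ρ (ω : 𝒜.sets → ℝ) (a : {a : 𝒜.sets // (a : Set T) ⊆ B}) : ℝ := ω a
  have hρ : Measurable ρ := by fun_prop
  let ν₁ := (P.restrict (𝒜.coordinateCombination f' ⁻¹' Γ)).map ρ
  let ν₂ := (P.withDensity fun ω => Q.kernel B B' (𝒜.coordinateCombination f ω) Γ).map ρ
  have hfin : IsFiniteMeasure ν₁ := Measure.isFiniteMeasure_map _ _
  have hν : ν₂ = ν₁ := by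
    let R (J : Finset {a : 𝒜.sets // (a : Set T) ⊆ B}) : Measure (J → ℝ) := ν₁.map J.restrict
    have hR J : IsFiniteMeasure (R J) := Measure.isFiniteMeasure_map _ _
    refine IsProjectiveLimit.unique (α := fun _ => ℝ) (P := R) (fun J => ?_) fun J => rfl
    have hJ : Measurable (Finset.restrict (π := fun _ => ℝ) J) := Finset.measurable_restrict J
    ext G hG
    simp only [R, ν₁, ν₂]
    rw [Measure.map_map hJ hρ, Measure.map_map hJ hρ, Measure.map_apply (hJ.comp hρ) hG,
      Measure.map_apply (hJ.comp hρ) hG, Measure.restrict_apply ((hJ.comp hρ) hG),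
      withDensity_apply _ ((hJ.comp hρ) hG)]
    have h := congrArg (fun ν => ν ((G ×ˢ Set.univ) ×ˢ Γ)) (hP.map_eq_compProd hB hB' hne hBB' hf hf'
      (F := fun j : J => (j : {a : 𝒜.sets // (a : Set T) ⊆ B}).1) fun j => j.1.2)
    have := Measure.isProbabilityMeasure_map (μ := P)
      (f := fun ω => (fun j : J => ω (j : {a : 𝒜.sets // (a : Set T) ⊆ B}).1,
        𝒜.coordinateCombination f ω)) (by fun_prop)
    have hG' : MeasurableSet (G ×ˢ (Set.univ : Set ℝ)) := hG.prod .univ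
    simp only at h
    rw [Measure.map_apply (by fun_prop) (hG'.prod hΓ), Measure.compProd_apply_prod hG' hΓ,
      setLIntegral_map hG' (by exact Kernel.measurable_coe _ hΓ) (by fun_prop)] at h
    have hpre : (fun ω : 𝒜.sets → ℝ => (fun j : J => ω (j : {a : 𝒜.sets // (a : Set T) ⊆ B}).1,
        𝒜.coordinateCombination f ω)) ⁻¹' (G ×ˢ Set.univ) = (J.restrict ∘ ρ) ⁻¹' G := by
      ext ω
      simp only [Set.mem_preimage, Set.mem_prod, Set.mem_univ, and_true]
      rfl
    rw [hpre] at h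
    refine Eq.trans h.symm (congrArg P ?_)
    ext ω
    simp only [Set.mem_preimage, Set.mem_prod, Set.mem_univ, and_true, Set.mem_inter_iff]
    rfl
  rw [history_eq_comap] at hs
  obtain ⟨G, hG, rfl⟩ := hs
  have h := congrArg (fun ν => ν G) hν
  simp only [ν₁, ν₂] at h
  rwa [Measure.map_apply hρ hG, Measure.map_apply hρ hG, Measure.restrict_apply (hρ hG),
    withDensity_apply _ (hρ hG)] at h

theorem HasChainLaws.condExp_ae_eq [IsProbabilityMeasure P] (hP : HasChainLaws Q μ P)
    {B B' : Set T} (hB : B ∈ 𝒜.Au) (hB' : B' ∈ 𝒜.Au) (hne : B.Nonempty) (hBB' : B ⊆ B')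
    {f f' : 𝒜.sets →₀ ℝ} (hf : 𝒜.indicatorCombination f = B.indicator 1)
    (hfB : ∀ a ∈ f.support, (a : Set T) ⊆ B)
    (hf' : 𝒜.indicatorCombination f' = B'.indicator 1) {Γ : Set ℝ} (hΓ : MeasurableSet Γ) :
    P[(𝒜.coordinateCombination f' ⁻¹' Γ).indicator (fun _ => (1 : ℝ)) |
        history (fun (a : 𝒜.sets) (ω : 𝒜.sets → ℝ) => ω a) B] =ᵐ[P]
      fun ω => (Q.kernel B B' (𝒜.coordinateCombination f ω)).real Γ := by
  have hmf := 𝒜.measurable_coordinateCombination f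
  have hmf' := 𝒜.measurable_coordinateCombination f'
  have hker := Q.isMarkovKernel B hB B' hB' hne hBB'
  have hκ : Measurable fun ω => Q.kernel B B' (𝒜.coordinateCombination f ω) Γ :=
    ((Q.kernel B B').measurable_coe hΓ).comp hmf
  have hle : history (fun (a : 𝒜.sets) (ω : 𝒜.sets → ℝ) => ω a) B ≤ MeasurableSpace.pi :=
    iSup₂_le fun a _ => (measurable_pi_apply a).comap_le
  have hint : Integrable (fun ω => (Q.kernel B B' (𝒜.coordinateCombination f ω)).real Γ) P :=
    Integrable.of_bound hκ.ennreal_toReal.aestronglyMeasurable 1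
      (Filter.Eventually.of_forall fun ω => by
        rw [Real.norm_of_nonneg measureReal_nonneg]
        exact measureReal_le_one)
  symm
  refine ae_eq_condExp_of_forall_setIntegral_eq hle
    ((integrable_const 1).indicator (hmf' hΓ)) (fun s _ _ => hint.integrableOn)
    (fun s hs _ => ?_) ?_
  · rw [setIntegral_indicator (hmf' hΓ), setIntegral_const, smul_eq_mul, mul_one, measureReal_def,
      ← hP.setLIntegral_kernel hB hB' hne hBB' hf hf' hΓ hs]
    exact integral_toReal hκ.aemeasurable (Filter.Eventually.of_forall fun ω => measure_lt_top _ _)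
  · refine Measurable.aestronglyMeasurable ?_
    -- The support of `f` consists of subsets of `B`, so the value at `B` is measurable with respect
    -- to the history.
    have h : Measurable[history (fun (a : 𝒜.sets) (ω : 𝒜.sets → ℝ) => ω a) B]
        (𝒜.coordinateCombination f) := by
      have : 𝒜.coordinateCombination f = fun ω => ∑ a ∈ f.support, f a * ω a :=
        funext (𝒜.coordinateCombination_apply f)
      rw [this]
      refine Finset.measurable_sum _ fun a ha => Measurable.const_mul ?_ _
      exact (comap_measurable _).mono (le_iSup₂_of_le a (hfB a ha) le_rfl) le_rfl
    exact (((Q.kernel B B').measurable_coe hΓ).comp h).ennreal_toReal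

/-- Chain position `0` carries `∅'`, so the signed-measure description identifies this coordinate
with `x 0`, which has law `μ`. -/
theorem HasChainLaws.map_minSet (hP : HasChainLaws Q μ P) :
    P.map (fun ω => ω ⟨𝒜.minSet, 𝒜.minSet_mem⟩) = μ := by
  let I : Finset 𝒜.sets := {⟨𝒜.minSet, 𝒜.minSet_mem⟩}
  let i : I := ⟨⟨𝒜.minSet, 𝒜.minSet_mem⟩, Finset.mem_singleton_self _⟩
  have hS := isFiniteSubsemilattice_of_finset I
  have hmin := IndexingCollection.minSet_mem_generatedSemilattice (𝒜 := 𝒜)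
      (F := Subtype.val '' (I : Set 𝒜.sets))
  obtain ⟨n, A, hA, -⟩ := exists_isConsistentOrdering hS.finite (fun _ => 0) monotone_const
  have hU := 𝒜.isSetChain_chainSet fun i => hS.subset (hA.mem i)
  have hval : Measurable fun x (a : I) => orderingValue A x (a : 𝒜.sets) :=
    measurable_pi_lambda _ fun a => measurable_orderingValue _ _
  calc P.map (fun ω => ω ⟨𝒜.minSet, 𝒜.minSet_mem⟩) = (P.map I.restrict).map (fun y => y i) := by
        have h : Measurable (Finset.restrict (π := fun _ : 𝒜.sets => ℝ) I) :=
          Finset.measurable_restrict _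
        exact (Measure.map_map (measurable_pi_apply i) h).symm
    _ = (Q.chainLaw μ (chainSet 𝒜 A) n).map (fun x => x 0) := by
        rw [hP I n A hA, Measure.map_map (by fun_prop) hval]
        refine Measure.map_congr ?_
        filter_upwards [chainLaw_ae_exists_mass Q μ hA hS hmin] with x ⟨w, hw⟩
        obtain rfl : x = fun k : Fin (n + 1) => mass w (chainSet 𝒜 A k) := funext hw
        refine (orderingValue_mass hA hS hmin (.inl hmin) w).trans ?_
        simp [chainSet]
    _ = (Q.chainLaw μ (chainSet 𝒜 A) 0).map (fun x => x 0) := by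
        have hr : Measurable fun (x : Fin (n + 1) → ℝ) (i : Fin (0 + 1)) =>
          x (Fin.castLE (by omega) i) := measurable_pi_lambda _ fun _ => measurable_pi_apply _
        rw [← Q.chainLaw_map_castLE μ hU n.zero_le, Measure.map_map (by fun_prop) hr]
        rfl
    _ = μ := by
        rw [TransitionSystem.chainLaw, Measure.map_map (by fun_prop) (by fun_prop)]
        exact Measure.map_id

end Markov

/-! ### The existence theorem -/

theorem theorem1 {T : Type u} [TopologicalSpace T] [CompactSpace T] [T2Space T] [Nonempty T]
    (𝒜 : IndexingCollection T) (μ : Measure ℝ) [IsProbabilityMeasure μ]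
    (Q : TransitionSystem 𝒜) (hQ : Q.Consistent μ) :
    ∃ (Ω : Type u) (_ : MeasurableSpace Ω) (P : Measure Ω) (_ : IsProbabilityMeasure P)
      (X : 𝒜.sets → Ω → ℝ),
      IsQMarkov Q P X ∧ P.map (X ⟨𝒜.minSet, 𝒜.minSet_mem⟩) = μ := by
  obtain ⟨P, hPprob, hP⟩ := exists_hasChainLaws hQ
  refine ⟨𝒜.sets → ℝ, inferInstance, P, hPprob, fun a ω => ω a, ⟨measurable_pi_apply,
    ⟨⟨_, hP.isAdditiveExtension⟩, fun Y Y' hY hY' D hD => hY.ae_eq hY' hD⟩, ?_⟩, hP.map_minSet⟩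
  intro Y hY B hB B' hB' hne hBB' Γ hΓ
  have hAuCu : ∀ D ∈ 𝒜.Au, D ∈ 𝒜.Cu := fun D ⟨n, A, hA, hD⟩ =>
    ⟨n, A, fun i => 𝒜.mem_C_of_mem (hA i), hD⟩
  obtain ⟨f, hf, hfB⟩ := 𝒜.exists_indicatorCombination_eq_of_mem_Au hB
  obtain ⟨f', hf', -⟩ := 𝒜.exists_indicatorCombination_eq_of_mem_Au hB'
  -- The Markov property concerns every additive extension; by uniqueness its values at `B` and `B'`
  -- may be replaced by the linear combinations for which the property was shown.
  have hYB := (hY.ae_eq hP.isAdditiveExtension (hAuCu B hB)).trans (hP.coordinateExtension_ae_eq hf)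
  have hYB' :=
    (hY.ae_eq hP.isAdditiveExtension (hAuCu B' hB')).trans (hP.coordinateExtension_ae_eq hf')
  refine (condExp_congr_ae ?_).trans ((hP.condExp_ae_eq hB hB' hne hBB' hf hfB hf' hΓ).trans ?_)
  · filter_upwards [hYB'] with ω hω
    exact Set.indicator_eq_indicator (by rw [Set.mem_preimage, Set.mem_preimage, hω]) rfl
  · filter_upwards [hYB] with ω hω
    rw [hω]
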